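/- For a finite simple connected graph $G=(V,E)$ with $n=|V|$: for distinct $u,v\in V$ let the monophonic interval $I(u,v)$ be the set of vertices lying on some induced (chordless) path between $u$ and $v$. A set $X\subseteq V$ is m-convex if $I(u,v)\subseteq X$ for all distinct $u,v\in X$, and an m-halfspace if both $X$ and $V\setminus X$ are m-convex (so $\emptyset$ and $V$ are m-halfspaces). Let $\mathcal H_{\mathrm m}(G)$ be the set of all m-halfspaces of $G$. Let $h(G)$ be the monophonic hull number, i.e. the minimum size of a set $A\subseteq V$ such that the only m-convex set containing $A$ is $V$; let $\operatorname{diam}_g(G)$ be the diameter of $G$ with respect to the shortest-path distance, and $\omega(G)$ the clique number of $G$. In active learning, an algorithm is given $G$, and some $H\in\mathcal H_{\mathrm m}(G)$ unknown to it is fixed; the algorithm may adaptively query any vertex $x$ for its label $\mathbb 1_{x\in H}$, and it has to output $H$. Theorem (Poly-time active learning). There are a single deterministic algorithm $A$, a polynomial $p$ and a constant $C$ such that, for every finite connected graph $G$ on $n\ge 1$ vertices (given by its adjacency matrix) and every $H\in\mathcal H_{\mathrm m}(G)$, the algorithm $A$ halts within $p(n)$ steps, outputs exactly $H$, and makes at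 most \[ C\cdot\bigl(h(G)+\log\operatorname{diam}_g(G)+\omega(G)\bigr) \] label queries, where $\log\operatorname{diam}_g(G)$ is read as $0$ if $n=1$. Here a step is a step of a random access machine with unit-cost addition, truncated subtraction, halving and comparison (no multiplication). -/

import Mathlib

namespace Monophonic

/-! ### Monophonic convexity -/

section Convexity

variable {V : Type*}

/-- The monophonic interval `I(u,v)`: all vertices lying on some induced (chordless) path between
`u` and `v`.  For `u = v` it is `{u}`; this value has no influence on which sets are convex. -/
def mInterval (G : SimpleGraph V) (u v : V) : Set V :=
  {z | ∃ p : G.Walk u v, p.IsPath ∧ p.IsChordless ∧ z ∈ p.support}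

/-- Monophonically convex sets of vertices.  (In a connected graph, a nonempty such set
automatically induces a connected subgraph, as shortest paths are induced paths.) -/
def IsMConvex (G : SimpleGraph V) (X : Set V) : Prop :=
  ∀ u ∈ X, ∀ v ∈ X, mInterval G u v ⊆ X

/-- The concept class of all monophonic halfspaces of `G`. -/
def mHalfspaces (G : SimpleGraph V) : Set (Set V) :=
  {H | IsMConvex G H ∧ IsMConvex G Hᶜ}

/-- The monophonic convex hull: the intersection of all m-convex sets containing `A`. -/
def mHull (G : SimpleGraph V) (A : Set V) : Set V :=
  ⋂₀ {C | IsMConvex G C ∧ A ⊆ C}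

/-- The monophonic hull number `h(G)`: the least size of a set whose hull is everything. -/
noncomputable def mHullNumber (G : SimpleGraph V) : ℕ :=
  sInf {k | ∃ A : Finset V, A.card = k ∧ mHull G (A : Set V) = Set.univ}

end Convexity

/-! ### A machine model for active learning on graphs

Algorithms are programs of a deterministic random access machine with structured control flow.
The machine has scalar registers and two-dimensional tables, all holding natural numbers and
initially `0`.  It has read-only random access to the number `n` of vertices and to the adjacency
matrix of the input graph on `{0, …, n-1}`.  The arithmetic at unit cost is addition, truncated
subtraction, halving and comparison (no multiplication), so that a number produced within `t` steps
has `O(t)` bits and unit-cost time is polynomially related to Turing machine time.  The unknown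
concept is accessible through label queries only, and queries are counted. -/

/-- Expressions. A comparison or adjacency test has value `1` if it holds and `0` otherwise. -/
inductive Expr where
  /-- a numeral -/
  | num (k : ℕ)
  /-- the content of a scalar register -/
  | var (x : ℕ)
  /-- the content of cell `(i, j)` of table `a` -/
  | cell (a : ℕ) (i j : Expr)
  /-- the number of vertices of the input graph -/
  | size
  /-- adjacency of two vertices of the input graph -/
  | adj (i j : Expr)
  | add (e f : Expr)
  /-- truncated subtraction -/
  | sub (e f : Expr)
  /-- rounded-down division by two -/
  | half (e : Expr)
  | lt (e f : Expr)
  | eq (e f : Expr)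

/-- Programs. -/
inductive Cmd where
  | skip
  /-- write the value of `e` to register `x` -/
  | assign (x : ℕ) (e : Expr)
  /-- write the value of `e` to cell `(i, j)` of table `a` -/
  | store (a : ℕ) (i j e : Expr)
  /-- query the label of vertex `e`, and write the answer (`0` or `1`) to register `x` -/
  | query (x : ℕ) (e : Expr)
  | seq (c d : Cmd)
  /-- run `c` if `e` is nonzero, and `d` otherwise -/
  | ite (e : Expr) (c d : Cmd)
  /-- run `c` as long as `e` is nonzero -/
  | while (e : Expr) (c : Cmd)

/-- The memory of the machine. -/
@[ext]
structure State where
  reg : ℕ → ℕ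
  tab : ℕ → ℕ → ℕ → ℕ

/-- The initial memory: zero everywhere. -/
def State.init : State := ⟨fun _ => 0, fun _ _ _ => 0⟩

def State.setReg (s : State) (x k : ℕ) : State :=
  { s with reg := fun y => if y = x then k else s.reg y }

def State.setTab (s : State) (a i j k : ℕ) : State :=
  { s with tab := fun a' i' j' => if a' = a ∧ i' = i ∧ j' = j then k else s.tab a' i' j' }

/-- The time needed to evaluate an expression: the number of its nodes. -/
def Expr.cost : Expr → ℕ
  | num _ => 1
  | var _ => 1
  | cell _ i j => 1 + i.cost + j.cost
  | size => 1
  | adj i j => 1 + i.cost + j.cost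
  | add e f => 1 + e.cost + f.cost
  | sub e f => 1 + e.cost + f.cost
  | half e => 1 + e.cost
  | lt e f => 1 + e.cost + f.cost
  | eq e f => 1 + e.cost + f.cost

section Semantics

variable {n : ℕ}

open Classical in
/-- The entry `(i, j)` of the adjacency matrix (`0` outside of the range). -/
noncomputable def adjBit (G : SimpleGraph (Fin n)) (i j : ℕ) : ℕ :=
  if ∃ (hi : i < n) (hj : j < n), G.Adj ⟨i, hi⟩ ⟨j, hj⟩ then 1 else 0

open Classical in
/-- The label of vertex `i` under the concept `H` (`0` outside of the range). -/
noncomputable def labelBit (H : Set (Fin n)) (i : ℕ) : ℕ :=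
  if ∃ hi : i < n, (⟨i, hi⟩ : Fin n) ∈ H then 1 else 0

/-- The value of an expression on the input graph `G` in memory `s`. -/
noncomputable def Expr.eval (G : SimpleGraph (Fin n)) (s : State) : Expr → ℕ
  | num k => k
  | var x => s.reg x
  | cell a i j => s.tab a (i.eval G s) (j.eval G s)
  | size => n
  | adj i j => adjBit G (i.eval G s) (j.eval G s)
  | add e f => e.eval G s + f.eval G s
  | sub e f => e.eval G s - f.eval G s
  | half e => e.eval G s / 2
  | lt e f => if e.eval G s < f.eval G s then 1 else 0
  | eq e f => if e.eval G s = f.eval G s then 1 else 0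

/-- `Exec G H c s s' t q`: on input graph `G`, with the labels given by `H`, the program `c` started
in memory `s` halts in memory `s'` after `t` steps, having made `q` label queries. -/
inductive Exec (G : SimpleGraph (Fin n)) (H : Set (Fin n)) :
    Cmd → State → State → ℕ → ℕ → Prop where
  | skip (s : State) : Exec G H .skip s s 1 0
  | assign (x : ℕ) (e : Expr) (s : State) :
      Exec G H (.assign x e) s (s.setReg x (e.eval G s)) (1 + e.cost) 0
  | store (a : ℕ) (i j e : Expr) (s : State) :
      Exec G H (.store a i j e) s (s.setTab a (i.eval G s) (j.eval G s) (e.eval G s))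
        (1 + i.cost + j.cost + e.cost) 0
  | query (x : ℕ) (e : Expr) (s : State) :
      Exec G H (.query x e) s (s.setReg x (labelBit H (e.eval G s))) (1 + e.cost) 1
  | seq {c d : Cmd} {s s' s'' : State} {t t' q q' : ℕ} :
      Exec G H c s s' t q → Exec G H d s' s'' t' q' →
      Exec G H (.seq c d) s s'' (t + t') (q + q')
  | ite_true {e : Expr} {c d : Cmd} {s s' : State} {t q : ℕ} :
      e.eval G s ≠ 0 → Exec G H c s s' t q →
      Exec G H (.ite e c d) s s' (1 + e.cost + t) q
  | ite_false {e : Expr} {c d : Cmd} {s s' : State} {t q : ℕ} :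
      e.eval G s = 0 → Exec G H d s s' t q →
      Exec G H (.ite e c d) s s' (1 + e.cost + t) q
  | while_true {e : Expr} {c : Cmd} {s s' s'' : State} {t t' q q' : ℕ} :
      e.eval G s ≠ 0 → Exec G H c s s' t q → Exec G H (.while e c) s' s'' t' q' →
      Exec G H (.while e c) s s'' (1 + e.cost + t + t') (q + q')
  | while_false {e : Expr} {c : Cmd} {s : State} :
      e.eval G s = 0 → Exec G H (.while e c) s s (1 + e.cost) 0

/-- The machine is deterministic: the result, the time and the number of queries of a halting
run are determined by the program, the input, the labels and the initial memory. -/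
theorem Exec.deterministic {G : SimpleGraph (Fin n)} {H : Set (Fin n)} {c : Cmd}
    {s s₁ s₂ : State} {t₁ t₂ q₁ q₂ : ℕ} (h₁ : Exec G H c s s₁ t₁ q₁)
    (h₂ : Exec G H c s s₂ t₂ q₂) : s₁ = s₂ ∧ t₁ = t₂ ∧ q₁ = q₂ := by
  induction h₁ generalizing s₂ t₂ q₂ with
  | skip | assign | store | query => cases h₂; simp
  | seq _ _ ih ih' =>
    cases h₂ with
    | seq a b =>
      obtain ⟨rfl, rfl, rfl⟩ := ih a
      obtain ⟨rfl, rfl, rfl⟩ := ih' b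
      simp
  | ite_true he _ ih =>
    cases h₂ with
    | ite_true _ a => obtain ⟨rfl, rfl, rfl⟩ := ih a; simp
    | ite_false h => exact absurd h he
  | ite_false he _ ih =>
    cases h₂ with
    | ite_true h => exact absurd he h
    | ite_false _ a => obtain ⟨rfl, rfl, rfl⟩ := ih a; simp
  | while_true he _ _ ih ih' =>
    cases h₂ with
    | while_true _ a b =>
      obtain ⟨rfl, rfl, rfl⟩ := ih a
      obtain ⟨rfl, rfl, rfl⟩ := ih' b
      simp
    | while_false h => exact absurd h he
  | while_false he =>
    cases h₂ with
    | while_true h => exact absurd he h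
    | while_false => simp

/-- The set of vertices output by a halted run: vertex `v` is in the output if and only if
cell `(v, 0)` of table `0` is nonzero. -/
def State.output (n : ℕ) (s : State) : Set (Fin n) :=
  {v | s.tab 0 v 0 ≠ 0}

/-- The program `P`, given the graph `G`, actively learns the concept class `𝓗` in time at most `T`
with query complexity at most `Q`: whichever `H ∈ 𝓗` provides the labels, `P` halts after at most
`T` steps and at most `Q` label queries, and outputs exactly `H`. -/
def ActivelyLearns (P : Cmd) (G : SimpleGraph (Fin n)) (𝓗 : Set (Set (Fin n))) (T : ℕ) (Q : ℝ) :
    Prop :=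
  ∀ H ∈ 𝓗, ∃ (s : State) (t q : ℕ),
    Exec G H P State.init s t q ∧ s.output n = H ∧ t ≤ T ∧ (q : ℝ) ≤ Q

end Semantics

end Monophonic

namespace Monophonic

section GraphTheory

open SimpleGraph Relation

variable {V : Type*} {G : SimpleGraph V}

/-! ### Chordless paths -/

/-! The learner exploits the structure of the cut between a halfspace `H` and its complement. Both
sides are connected, and the ends of cut edges on one side form a clique (`adj_of_cut`,
`adj_of_cut'`): two nonadjacent ones would be joined by an induced path through the other side. So
one cut edge `ab` with `a ∈ H` reveals almost everything. Every cut edge has its end in `H` in the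
closed neighbourhood of `a` and its other end in that of `b`. A vertex other than `b` adjacent to
`a` only lies in `H`, and one other than `a` adjacent to `b` only lies outside. The common
neighbours split into a clique in `H` and a clique outside, so at most `2ω` labels must be queried
(`card_triangles_le`). All cut edges are then known, and `H` is the component of `a` after their
deletion (`run_spreadProg`).

A cut edge is found by bisecting geodesics between a positive and a negative vertex
(`run_searchProg`), with logarithmically many queries in the diameter. Such a pair comes from
querying a hull set: if all its labels agree, its hull lies on one side, so `H` is empty or
everything.

The hull set used is only inclusion-minimal, which a greedy deletion achieves, but its size is at
most `2h` (`card_le_of_minimal`). For `v` in a minimal hull set `S`, consider the component of `v`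
in the complement of the hull of `S \ {v}`. Its boundary is a clique, so its complement is convex
and every hull set must meet it. No vertex lies in three of these components (`not_mem_three_comp`),
whence the factor 2.

For polynomial time, convexity is put into a form that mentions only the first edge of an induced
path and reachability (`isMConvex_iff`). The hull becomes a least fixed point on pairs of vertices
(`diag_eq_mHull`), reached within `n * n` rounds. All programs use loops over the vertices only, so
halting and a polynomial time bound follow by structural induction (`exec_compile`). -/

theorem isChordless_of_cons {u w v : V} {h : G.Adj u w} {p : G.Walk w v}
    (hp : (Walk.cons h p).IsPath) (hc : (Walk.cons h p).IsChordless) : p.IsChordless := by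
  rw [Walk.isChordless_iff_forall_mem_edges] at hc ⊢
  rw [Walk.cons_isPath_iff] at hp
  intro x y hx hy hxy
  have := hc (u' := x) (v' := y) (by simp [hx]) (by simp [hy]) hxy
  rw [Walk.edges_cons, List.mem_cons] at this
  rcases this with h' | h'
  · rw [Sym2.eq_iff] at h'
    rcases h' with ⟨rfl, _⟩ | ⟨_, rfl⟩
    · exact absurd hx hp.2
    · exact absurd hy hp.2
  · exact h'

theorem isChordless_cons {u w v : V} (h : G.Adj u w) {p : G.Walk w v}
    (hc : p.IsChordless) (hu : ∀ z ∈ p.support, G.Adj u z → z = w) :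
    (Walk.cons h p).IsChordless := by
  rw [Walk.isChordless_iff_forall_mem_edges] at hc ⊢
  intro x y hx hy hxy
  rw [Walk.support_cons, List.mem_cons] at hx hy
  rw [Walk.edges_cons, List.mem_cons]
  rcases hx with rfl | hx <;> rcases hy with rfl | hy
  · exact absurd hxy G.irrefl
  · exact .inl (by rw [hu y hy hxy])
  · exact .inl (by rw [hu x hx hxy.symm, Sym2.eq_swap])
  · exact .inr (hc hx hy hxy)

/-- Enter `p` at its last vertex that is equal or adjacent to `a`; no later vertex can then create a
chord. The induction moves along `p` as long as the remaining tail still touches `a`. -/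
theorem exists_chordless_of_mem {c v : V} (p : G.Walk c v) (hp : p.IsPath) (hc : p.IsChordless)
    {a : V} (ha : ∃ z ∈ p.support, G.Adj a z ∨ z = a) :
    ∃ q : G.Walk a v, q.IsPath ∧ q.IsChordless ∧ ∀ z ∈ q.support, z = a ∨ z ∈ p.support := by
  induction p with
  | nil =>
    obtain ⟨z, hz, hz'⟩ := ha
    rw [Walk.support_nil, List.mem_singleton] at hz
    subst hz
    rcases hz' with h | rfl
    · refine ⟨h.toWalk, ?_, h.isChordless_toWalk, ?_⟩
      · simp [h.ne]
      · simp
    · exact ⟨.nil, hp, hc, by simp⟩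
  | @cons c d v h p ih =>
    by_cases hz : ∃ z ∈ p.support, G.Adj a z ∨ z = a
    · obtain ⟨q, h1, h2, h3⟩ := ih hp.of_cons (isChordless_of_cons hp hc) hz
      exact ⟨q, h1, h2, fun z hz => (h3 z hz).imp_right (by simp +contextual)⟩
    · push Not at hz
      obtain ⟨z, hz1, hz2⟩ := ha
      rw [Walk.support_cons, List.mem_cons] at hz1
      rcases hz1 with rfl | hz1
      · rcases hz2 with h' | rfl
        · refine ⟨.cons h' (.cons h p), ?_, isChordless_cons h' hc ?_, by simp⟩
          · rw [Walk.cons_isPath_iff]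
            refine ⟨hp, ?_⟩
            rw [Walk.support_cons, List.mem_cons]
            rintro (rfl | hh)
            · exact G.irrefl h'
            · exact (hz _ hh).2 rfl
          · intro y hy hay
            rw [Walk.support_cons, List.mem_cons] at hy
            rcases hy with rfl | hy
            · rfl
            · exact absurd hay (hz _ hy).1
        · exact ⟨.cons h p, hp, hc, fun z hz => .inr hz⟩
      · have := hz z hz1
        tauto

/-- `Joins G P x y`: there is a walk from `x` to `y` all of whose vertices after `x`
satisfy `P`. -/
def Joins (G : SimpleGraph V) (P : V → Prop) : V → V → Prop :=
  ReflTransGen fun a b => G.Adj a b ∧ P b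

theorem Joins.exists_chordless {P : V → Prop} {w v : V} (h : Joins G P w v) :
    ∃ p : G.Walk w v, p.IsPath ∧ p.IsChordless ∧ ∀ z ∈ p.support, z = w ∨ P z := by
  induction h using ReflTransGen.head_induction_on with
  | refl =>
    exact ⟨.nil, by simp, by rw [Walk.isChordless_iff_forall_mem_edges]; simp +contextual, by simp⟩
  | @head a c hac _ ih =>
    obtain ⟨p, h1, h2, h3⟩ := ih
    obtain ⟨q, k1, k2, k3⟩ := exists_chordless_of_mem p h1 h2 (a := a)
      ⟨c, p.start_mem_support, .inl hac.1⟩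
    refine ⟨q, k1, k2, fun z hz => (k3 z hz).imp_right fun hz => ?_⟩
    rcases h3 z hz with rfl | h
    · exact hac.2
    · exact h

theorem joins_of_walk {P : V → Prop} {w v : V} (p : G.Walk w v)
    (h : ∀ z ∈ p.support.tail, P z) : Joins G P w v := by
  induction p with
  | nil => exact .refl
  | cons ha p ih =>
    simp only [Walk.support_cons, List.tail_cons] at h
    exact .head ⟨ha, h _ p.start_mem_support⟩ (ih fun z hz => h z (List.mem_of_mem_tail hz))

theorem Joins.mem {P : V → Prop} {w v : V} (h : Joins G P w v) (hw : P w) : P v := by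
  induction h with
  | refl => exact hw
  | tail _ h _ => exact h.2

theorem Joins.symm {P : V → Prop} {w v : V} (h : Joins G P w v) (hw : P w) : Joins G P v w := by
  induction h with
  | refl => exact .refl
  | @tail b c hb h ih => exact .head ⟨h.1.symm, Joins.mem hb hw⟩ ih

/-! ### Convex sets -/

/-- The vertices outside of the closed neighbourhood of `u`. -/
def Far (G : SimpleGraph V) (u z : V) : Prop := ¬ G.Adj u z ∧ z ≠ u

/-- An induced path from `u` meets the closed neighbourhood of `u` only in `u` and the second vertex
`w`. Conversely, any walk from `w` that is far from `u` after its start can be made chordless and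
prolonged by `u`. Induced paths thus give way to reachability, and the rest of a path is absorbed by
induction with `w` as the new start. -/
theorem isMConvex_iff {X : Set V} : IsMConvex G X ↔
    ∀ u ∈ X, ∀ v ∈ X, ∀ w, G.Adj u w → Joins G (Far G u) w v → w ∈ X := by
  constructor
  · intro hX u hu v hv w huw hwv
    obtain ⟨p, h1, h2, h3⟩ := hwv.exists_chordless
    refine hX u hu v hv ⟨.cons huw p, ?_, isChordless_cons huw h2 ?_, by simp⟩
    · rw [Walk.cons_isPath_iff]
      refine ⟨h1, fun h => ?_⟩
      rcases h3 u h with h | h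
      · exact huw.ne h
      · exact h.2 rfl
    · exact fun z hz huz => (h3 z hz).resolve_right fun h => h.1 huz
  · rintro h u hu v hv z ⟨p, h1, h2, h3⟩
    induction p with
    | nil =>
      rw [Walk.support_nil, List.mem_singleton] at h3
      exact h3 ▸ hu
    | @cons u w v huw p ih =>
      rw [Walk.support_cons, List.mem_cons] at h3
      rcases h3 with rfl | h3
      · exact hu
      have hp := Walk.cons_isPath_iff huw p |>.1 h1
      refine ih (h u hu v hv w huw (joins_of_walk p fun y hy => ⟨fun huy => ?_, ?_⟩)) hv hp.1
        (isChordless_of_cons h1 h2) h3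
      · have hyp := List.mem_of_mem_tail hy
        have := h2.mem_edges (u' := u) (v' := y) (by simp) (by simp [hyp]) huy
        rw [Walk.edges_cons, List.mem_cons] at this
        rcases this with h' | h'
        · rw [Sym2.congr_right] at h'
          subst h'
          have := hp.1.support_nodup
          rw [← Walk.cons_tail_support, List.nodup_cons] at this
          exact this.1 hy
        · exact hp.2 (p.fst_mem_support_of_mem_edges h')
      · rintro rfl
        exact hp.2 (List.mem_of_mem_tail hy)

/-- The vertices of a convex set that have neighbours in the same component of the complement
form a clique. -/
theorem IsMConvex.adj_of_joins {X : Set V} (hX : IsMConvex G X) {x x' y y' : V}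
    (hx : x ∈ X) (hx' : x' ∈ X) (hxy : G.Adj x y) (hxy' : G.Adj x' y') (hy : y ∉ X)
    (h : Joins G (· ∉ X) y y') (hne : x ≠ x') : G.Adj x x' := by
  rw [isMConvex_iff] at hX
  by_contra hnadj
  -- The walk from `y` to `y'` followed by `x'` is followed backwards from its end. A vertex of it
  -- adjacent to `x` would be forced into `X` by the local criterion, so the walk stays far from
  -- `x`.
  suffices Joins G (Far G x) y x' from hy (hX x hx x' hx' y hxy this)
  clear hxy hy
  induction h using ReflTransGen.head_induction_on with
  | refl => exact .single ⟨hxy'.symm, hnadj, hne.symm⟩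
  | @head a c hac _ ih =>
    exact .head ⟨hac.1, fun hxc => hac.2 (hX x hx x' hx' c hxc ih), fun h => hac.2 (h ▸ hx)⟩ ih

/-- A walk that enters `K` from `u` and stays far from `u` can leave `K` only at a boundary vertex
nonadjacent to `u` and different from it, against the boundary being a clique. -/
theorem isMConvex_compl {K : Set V}
    (hK : ∀ x ∉ K, ∀ x' ∉ K, ∀ y ∈ K, ∀ y' ∈ K, G.Adj x y → G.Adj x' y' → x ≠ x' → G.Adj x x') :
    IsMConvex G Kᶜ := by
  rw [isMConvex_iff]
  intro u hu v hv w huw hwv hw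
  suffices ∃ y ∈ K, ∃ c ∉ K, G.Adj y c ∧ Far G u c by
    obtain ⟨y, hy, c, hc, hyc, hf⟩ := this
    exact hf.1 (hK u hu c hc w hw y hy huw hyc.symm hf.2.symm)
  clear huw
  induction hwv using ReflTransGen.head_induction_on with
  | refl => exact absurd hw hv
  | @head a c hac _ ih =>
    by_cases hc : c ∈ K
    · exact ih hc
    · exact ⟨a, hw, c, hc, hac⟩

theorem IsMConvex.joins (hG : G.Connected) {X : Set V} (hX : IsMConvex G X) {u v : V}
    (hu : u ∈ X) (hv : v ∈ X) : Joins G (· ∈ X) u v := by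
  obtain ⟨w⟩ := hG.preconnected u v
  obtain ⟨p, h1, h2, -⟩ := (joins_of_walk (P := fun _ => True) w (by simp)).exists_chordless
  exact joins_of_walk p fun z hz => hX u hu v hv ⟨p, h1, h2, List.mem_of_mem_tail hz⟩

theorem subset_mHull (A : Set V) : A ⊆ mHull G A :=
  Set.subset_sInter fun _ h => h.2

theorem mHull_subset {A C : Set V} (hC : IsMConvex G C) (h : A ⊆ C) : mHull G A ⊆ C :=
  Set.sInter_subset_of_mem ⟨hC, h⟩

theorem isMConvex_mHull (A : Set V) : IsMConvex G (mHull G A) := by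
  intro u hu v hv z hz C hC
  exact hC.1 u (hu C hC) v (hv C hC) hz

/-! ### Minimal hull sets -/

/-- The component of `v` in the complement of `X`, if `v` lies there. -/
def comp (G : SimpleGraph V) (X : Set V) (v : V) : Set V := {y | Joins G (· ∉ X) v y}

theorem mem_comp_self (X : Set V) (v : V) : v ∈ comp G X v := ReflTransGen.refl

theorem comp_subset {X : Set V} {v : V} (hv : v ∉ X) : comp G X v ⊆ Xᶜ :=
  fun _ h => Joins.mem h hv

theorem mem_of_adj_comp {X : Set V} {v y x : V} (hy : y ∈ comp G X v) (hyx : G.Adj y x)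
    (hx : x ∉ comp G X v) : x ∈ X := by
  by_contra h
  exact hx (ReflTransGen.tail hy ⟨hyx, h⟩)

theorem comp_boundary {X : Set V} (hX : IsMConvex G X) {v : V} (hv : v ∉ X) :
    ∀ x ∉ comp G X v, ∀ x' ∉ comp G X v, ∀ y ∈ comp G X v, ∀ y' ∈ comp G X v,
      G.Adj x y → G.Adj x' y' → x ≠ x' → G.Adj x x' := by
  intro x hx x' hx' y hy y' hy' hxy hxy' hne
  exact hX.adj_of_joins (mem_of_adj_comp hy hxy.symm hx) (mem_of_adj_comp hy' hxy'.symm hx') hxy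
    hxy' (comp_subset hv hy) ((Joins.symm hy hv).trans hy') hne

/-- The vertices outside of `K` with a neighbour in `K`. -/
def boundary (G : SimpleGraph V) (K : Set V) : Set V := {x | x ∉ K ∧ ∃ y ∈ K, G.Adj x y}

theorem boundary_nonempty_of_comp {K X : Set V} {v x : V} (hv : v ∉ X)
    (hx : x ∈ comp G X v) (hxK : x ∈ K) (hvK : v ∉ K) :
    ∃ c ∈ boundary G K, c ∈ comp G X v := by
  have h := Joins.symm hx hv
  have key : ∀ y, Joins G (· ∉ X) x y → y ∈ K ∨ ∃ c ∈ boundary G K, Joins G (· ∉ X) x c := by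
    intro y hy
    induction hy with
    | refl => exact .inl hxK
    | @tail b c hb hbc ih =>
      rcases ih with ih | ih
      · by_cases hc : c ∈ K
        · exact .inl hc
        · exact .inr ⟨c, ⟨hc, b, ih, hbc.1.symm⟩, hb.tail hbc⟩
      · exact .inr ih
  obtain ⟨c, hc, hc'⟩ := (key v h).resolve_left hvK
  exact ⟨c, hc, ReflTransGen.trans hx hc'⟩

/-- No vertex lies in three of the components cut off by the hulls of `S \ {v}`. -/
theorem not_mem_three_comp {S : Set V} (hS : mHull G S = Set.univ) (X : V → Set V)
    (hX : ∀ v ∈ S, IsMConvex G (X v) ∧ v ∉ X v ∧ ∀ w ∈ S, w ≠ v → w ∈ X v) {v : Fin 3 → V}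
    (hv : ∀ i, v i ∈ S) (hinj : Function.Injective v) {x : V}
    (hx : ∀ i, x ∈ comp G (X (v i)) (v i)) : False := by
  set K : Fin 3 → Set V := fun i => comp G (X (v i)) (v i) with hKdef
  set C : Fin 3 → Set V := fun i => boundary G (K i) with hCdef
  have hvK : ∀ i, ∀ w ∈ S, w ≠ v i → w ∉ K i := fun i w hw hne h =>
    comp_subset (hX _ (hv i)).2.1 h ((hX _ (hv i)).2.2 w hw hne)
  have hclique : ∀ i, ∀ a ∈ C i, ∀ b ∈ C i, a ≠ b → G.Adj a b := by
    rintro i a ⟨ha, y, hy, hay⟩ b ⟨hb, y', hy', hby⟩ hne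
    exact comp_boundary (hX _ (hv i)).1 (hX _ (hv i)).2.1 a ha b hb y hy y' hy' hay hby hne
  -- `K j` contains `x ∈ K i` and `v j ∉ K i`, so it meets the boundary `C i` in some `d`. As `C i`
  -- is a clique, each of its vertices is `d` or adjacent to `d`, hence in `K j` or on its boundary.
  have hsub : ∀ i j, i ≠ j → ∀ c ∈ C i, c ∈ K j ∨ c ∈ C j := by
    intro i j hij c hc
    obtain ⟨d, hd, hd'⟩ := boundary_nonempty_of_comp (K := K i) (hX _ (hv j)).2.1 (hx j) (hx i)
      (hvK i _ (hv j) (fun h => hij (hinj h).symm))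
    by_cases hcj : c ∈ K j
    · exact .inl hcj
    · refine .inr ⟨hcj, d, hd', hclique i c hc d hd ?_⟩
      rintro rfl
      exact hcj hd'
  -- `Y` is a clique because any two pairs of indices out of three share an index. It separates `x`
  -- from all of `S`, so the complement of the component of `x` off `Y` is a proper convex set
  -- containing `S`.
  set Y : Set V := {y | ∃ i j, i ≠ j ∧ y ∈ C i ∧ y ∈ C j} with hY
  have hYclique : ∀ a ∈ Y, ∀ b ∈ Y, a ≠ b → G.Adj a b := by
    rintro a ⟨i, j, hij, hi, hj⟩ b ⟨k, l, hkl, hk, hl⟩ hne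
    have : i = k ∨ i = l ∨ j = k ∨ j = l := by
      revert hij hkl; clear hi hj hk hl; revert i j k l; decide
    rcases this with rfl | rfl | rfl | rfl
    · exact hclique _ a hi b hk hne
    · exact hclique _ a hi b hl hne
    · exact hclique _ a hj b hk hne
    · exact hclique _ a hj b hl hne
  have hxY : x ∉ Y := by
    rintro ⟨i, j, hij, hi, hj⟩
    exact hi.1 (hx i)
  have hD : IsMConvex G (comp G Y x)ᶜ := by
    refine isMConvex_compl fun a ha b hb y hy y' hy' hay hby hne => hYclique a ?_ b ?_ hne
    · exact mem_of_adj_comp hy hay.symm ha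
    · exact mem_of_adj_comp hy' hby.symm hb
  have hSD : S ⊆ (comp G Y x)ᶜ := by
    intro w hw hwD
    obtain ⟨i, j, hij, hwi, hwj⟩ : ∃ i j : Fin 3, i ≠ j ∧ w ≠ v i ∧ w ≠ v j := by
      by_cases h0 : w = v 0
      · exact ⟨1, 2, by decide, by rw [h0]; exact hinj.ne (by decide),
          by rw [h0]; exact hinj.ne (by decide)⟩
      by_cases h1 : w = v 1
      · exact ⟨0, 2, by decide, h0, by rw [h1]; exact hinj.ne (by decide)⟩
      · exact ⟨0, 1, by decide, h0, h1⟩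
    -- A walk from `w` avoiding `Y` cannot enter `K i` or `K j`: just before entering it would be on
    -- one of the boundaries, and by `hsub` then on both, hence in `Y`.
    have hstep : ∀ y, y ∉ Y → y ∉ K i → y ∉ K j → y ∉ C i ∧ y ∉ C j := by
      intro y hy hi hj
      refine ⟨fun h => ?_, fun h => ?_⟩
      · exact hy ⟨i, j, hij, h, (hsub i j hij y h).resolve_left hj⟩
      · exact hy ⟨i, j, hij, (hsub j i hij.symm y h).resolve_left hi, h⟩
    have key : ∀ y, Joins G (· ∉ Y) w y → y ∉ K i ∧ y ∉ K j ∧ y ∉ Y := by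
      intro y hy
      induction hy with
      | refl => exact ⟨hvK i w hw hwi, hvK j w hw hwj, comp_subset hxY hwD⟩
      | @tail b c hb hbc ih =>
        have hb' := hstep b ih.2.2 ih.1 ih.2.1
        exact ⟨fun h => hb'.1 ⟨ih.1, c, h, hbc.1⟩, fun h => hb'.2 ⟨ih.2.1, c, h, hbc.1⟩, hbc.2⟩
    exact (key x (Joins.symm hwD hxY)).1 (hx i)
  have : x ∈ (comp G Y x)ᶜ := mHull_subset hD hSD (hS ▸ Set.mem_univ x)
  exact this (mem_comp_self Y x)

/-- A hull set `A` of least size meets every component `comp G (X v) v`, since otherwise `A` lies in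
its convex complement. Choosing a point of `A` in each component gives a map from `S` to `A` whose
fibres have at most two elements. -/
theorem card_le_of_minimal [Fintype V] [DecidableEq V] {S : Finset V}
    (hS : mHull G (S : Set V) = Set.univ)
    (hmin : ∀ v ∈ S, mHull G ((S.erase v : Finset V) : Set V) ≠ Set.univ) :
    S.card ≤ 2 * mHullNumber G := by
  obtain ⟨A, hA, hAu⟩ : mHullNumber G ∈ {k | ∃ A : Finset V, A.card = k ∧
      mHull G (A : Set V) = Set.univ} := Nat.sInf_mem ⟨S.card, S, rfl, hS⟩
  set X : V → Set V := fun v => mHull G ((S.erase v : Finset V) : Set V) with hXdef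
  have hX : ∀ v ∈ (S : Set V), IsMConvex G (X v) ∧ v ∉ X v ∧
      ∀ w ∈ (S : Set V), w ≠ v → w ∈ X v := by
    intro v hv
    have h3 : ∀ w ∈ (S : Set V), w ≠ v → w ∈ X v := fun w hw hne =>
      subset_mHull _ (by simpa [hne] using hw)
    refine ⟨isMConvex_mHull _, fun h => hmin v hv ?_, h3⟩
    rw [Set.eq_univ_iff_forall]
    intro z
    refine mHull_subset (isMConvex_mHull _) (fun w hw => ?_) (hS ▸ Set.mem_univ z)
    by_cases hwv : w = v
    · exact hwv ▸ h
    · exact h3 w hw hwv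
  have hf : ∀ v ∈ S, ∃ a ∈ A, a ∈ comp G (X v) v := by
    intro v hv
    by_contra! hcon
    have := mHull_subset (G := G) (A := (A : Set V))
      (isMConvex_compl (comp_boundary (hX v hv).1 (hX v hv).2.1)) hcon (hAu ▸ Set.mem_univ v)
    exact this (mem_comp_self _ v)
  choose! f hfA hfK using hf
  rw [← hA]
  refine Finset.card_le_mul_card_image_of_maps_to hfA 2 fun a _ => ?_
  by_contra! hcard
  obtain ⟨p, hp, q, hq, r, hr, hpq, hpr, hqr⟩ := Finset.two_lt_card.1 hcard
  simp only [Finset.mem_filter] at hp hq hr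
  refine not_mem_three_comp hS X hX (v := ![p, q, r]) (x := a) ?_ ?_ ?_
  · intro i; fin_cases i
    exacts [hp.1, hq.1, hr.1]
  · intro i j; fin_cases i <;> fin_cases j <;> simp [hpq, hpr, hqr, hpq.symm, hpr.symm, hqr.symm]
  · intro i; fin_cases i
    exacts [hp.2 ▸ hfK p hp.1, hq.2 ▸ hfK q hq.1, hr.2 ▸ hfK r hr.1]

/-! ### The hull as a least fixed point

The following monotone operator acts on sets of pairs of vertices.  A diagonal pair `(u, u)`
records that `u` is in the hull, and a pair `(u, y)` with `y` outside of the closed neighbourhood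
of `u` that `y` is joined to the hull outside of this neighbourhood. -/

/-- One-step consequences of a set of pairs. -/
def hullStep (G : SimpleGraph V) (B : Set (V × V)) : Set (V × V) :=
  {c | ∃ u y w, ((y, y) ∈ B ∧ Far G u y ∧ c = (u, y)) ∨
    ((u, y) ∈ B ∧ Far G u y ∧ Far G u w ∧ G.Adj y w ∧ c = (u, w)) ∨
    ((u, u) ∈ B ∧ (u, y) ∈ B ∧ Far G u y ∧ G.Adj u w ∧ G.Adj y w ∧ c = (w, w))}

theorem diag_eq_mHull {S : Set V} {B : Set (V × V)} (hB : hullStep G B ⊆ B)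
    (hS : ∀ v ∈ S, (v, v) ∈ B)
    (hmin : ∀ C, hullStep G C ⊆ C → (∀ v ∈ S, (v, v) ∈ C) → B ⊆ C) :
    {v | (v, v) ∈ B} = mHull G S := by
  apply Set.Subset.antisymm
  -- This is the intended meaning of the pairs. It is closed under `hullStep`, so the least closed
  -- set `B` contains no unjustified pair.
  · set C : Set (V × V) := {c | (c.1 = c.2 ∧ c.1 ∈ mHull G S) ∨
      (Far G c.1 c.2 ∧ ∃ v ∈ mHull G S, Joins G (Far G c.1) c.2 v)} with hC
    have hBC : B ⊆ C := by
      refine hmin C ?_ fun v hv => .inl ⟨rfl, subset_mHull S hv⟩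
      rintro _ ⟨u, y, w, ⟨h1, h2, rfl⟩ | ⟨h1, h2, h3, h4, rfl⟩ | ⟨h1, h2, h3, h4, h5, rfl⟩⟩
      · rcases h1 with h | h
        · exact .inr ⟨h2, y, h.2, .refl⟩
        · exact absurd rfl h.1.2
      · rcases h1 with h | ⟨h, v, hv, hj⟩
        · exact absurd h.1.symm h2.2
        · exact .inr ⟨h3, v, hv, ReflTransGen.head ⟨h4.symm, h2⟩ hj⟩
      · rcases h1 with h1 | h1
        · rcases h2 with h | ⟨h, v, hv, hj⟩
          · exact absurd h.1.symm h3.2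
          · exact .inl ⟨rfl, isMConvex_iff.1 (isMConvex_mHull S) u h1.2 v hv w h4
              (ReflTransGen.head ⟨h5.symm, h3⟩ hj)⟩
        · exact absurd rfl h1.1.2
    intro v hv
    rcases hBC hv with h | h
    · exact h.2
    · exact absurd rfl h.1.2
  · refine mHull_subset (isMConvex_iff.2 ?_) hS
    intro u hu v hv w huw hwv
    have key : ∀ y, Joins G (Far G u) y v → Far G u y → (u, y) ∈ B := by
      intro y hy
      induction hy using ReflTransGen.head_induction_on with
      | refl => exact fun h => hB ⟨u, v, v, .inl ⟨hv, h, rfl⟩⟩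
      | @head a c hac _ ih =>
        exact fun h => hB ⟨u, c, a, .inr (.inl ⟨ih hac.2, hac.2, h, hac.1.symm, rfl⟩)⟩
    rcases hwv.cases_head with rfl | ⟨y, hy, hyv⟩
    · exact hv
    · exact hB ⟨u, y, w, .inr (.inr ⟨hu, key y hyv hy.2, hy.2, huw, hy.1.symm, rfl⟩)⟩

/-! ### Halfspaces -/

section Halfspace

variable {H : Set V} {a b : V}

/-- The complement of `H` is connected, so it forms one component and `IsMConvex.adj_of_joins`
applies to any two cut edges. -/
theorem adj_of_cut (hG : G.Connected) (hH : IsMConvex G H) (hH' : IsMConvex G Hᶜ) {x x' y y' : V}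
    (hx : x ∈ H) (hx' : x' ∈ H) (hy : y ∉ H) (hy' : y' ∉ H) (hxy : G.Adj x y)
    (hxy' : G.Adj x' y') (hne : x ≠ x') : G.Adj x x' :=
  hH.adj_of_joins hx hx' hxy hxy' hy (hH'.joins hG hy hy') hne

theorem adj_of_cut' (hG : G.Connected) (hH : IsMConvex G H) (hH' : IsMConvex G Hᶜ) {x x' y y' : V}
    (hx : x ∈ H) (hx' : x' ∈ H) (hy : y ∉ H) (hy' : y' ∉ H) (hxy : G.Adj x y)
    (hxy' : G.Adj x' y') (hne : y ≠ y') : G.Adj y y' :=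
  adj_of_cut hG hH' (by rwa [compl_compl]) hy hy' (not_not.2 hx) (not_not.2 hx') hxy.symm
    hxy'.symm hne

theorem card_triangles_le [Fintype V] (hG : G.Connected) (hH : IsMConvex G H)
    (hH' : IsMConvex G Hᶜ) (ha : a ∈ H) (hb : b ∉ H) (T : Finset V)
    (hT : ∀ z ∈ T, G.Adj a z ∧ G.Adj b z) : T.card ≤ 2 * G.cliqueNum := by
  classical
  have h1 : (T.filter (· ∈ H)).card ≤ G.cliqueNum := by
    refine IsClique.card_le_cliqueNum (t := T.filter (· ∈ H)) (tc := ?_)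
    intro x hx y hy hne
    simp only [Finset.coe_filter, Set.mem_ofPred_eq] at hx hy
    exact adj_of_cut hG hH hH' hx.2 hy.2 hb hb (hT _ hx.1).2.symm (hT _ hy.1).2.symm hne
  have h2 : (T.filter (¬ · ∈ H)).card ≤ G.cliqueNum := by
    refine IsClique.card_le_cliqueNum (t := T.filter (¬ · ∈ H)) (tc := ?_)
    intro x hx y hy hne
    simp only [Finset.coe_filter, Set.mem_ofPred_eq] at hx hy
    exact adj_of_cut' hG hH hH' ha ha hx.2 hy.2 (hT _ hx.1).1 (hT _ hy.1).1 hne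
  have := T.card_filter_add_card_filter_not (· ∈ H)
  omega

end Halfspace

/-! ### Intermediate vertices on geodesics. -/

theorem exists_dist_eq (hG : G.Connected) (u v : V) {k : ℕ} (hk : k ≤ G.dist u v) :
    ∃ m, G.dist u m = k ∧ G.dist u m + G.dist m v = G.dist u v := by
  obtain ⟨p, hp⟩ := hG.exists_walk_length_eq_dist u v
  have h1 := SimpleGraph.dist_le (p.take k)
  have h2 := SimpleGraph.dist_le (p.drop k)
  have h3 := hG.dist_triangle (u := u) (v := p.getVert k) (w := v)
  rw [Walk.take_length] at h1
  rw [Walk.drop_length] at h2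
  refine ⟨p.getVert k, ?_, ?_⟩ <;> omega

end GraphTheory

/-! ### Loop programs

A total fragment of the machine language: all loops run through the vertices. -/

/-- Programs whose only loops are `for x in {0, …, n-1}`. -/
inductive Prog where
  | skip
  | assign (x : ℕ) (e : Expr)
  | store (a : ℕ) (i j e : Expr)
  | query (x : ℕ) (e : Expr)
  | seq (c d : Prog)
  | ite (e : Expr) (c d : Prog)
  | loop (x : ℕ) (b : Prog)

namespace Prog

/-- Translation to machine programs. -/
def compile : Prog → Cmd
  | skip => .skip
  | assign x e => .assign x e
  | store a i j e => .store a i j e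
  | query x e => .query x e
  | seq c d => .seq c.compile d.compile
  | ite e c d => .ite e c.compile d.compile
  | loop x b => .seq (.assign x (.num 0))
      (.while (.lt (.var x) .size) (.seq b.compile (.assign x (.add (.var x) (.num 1)))))

/-- The registers a program may write to. -/
def regs : Prog → List ℕ
  | skip => []
  | assign x _ => [x]
  | store _ _ _ _ => []
  | query x _ => [x]
  | seq c d => c.regs ++ d.regs
  | ite _ c d => c.regs ++ d.regs
  | loop x b => x :: b.regs

/-- The tables a program may write to. -/
def tabs : Prog → List ℕ
  | skip => []
  | assign _ _ => []
  | store a _ _ _ => [a]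
  | query _ _ => []
  | seq c d => c.tabs ++ d.tabs
  | ite _ c d => c.tabs ++ d.tabs
  | loop _ b => b.tabs

/-- No loop body writes to its loop register. -/
def wf : Prog → Bool
  | skip => true
  | assign _ _ => true
  | store _ _ _ _ => true
  | query _ _ => true
  | seq c d => c.wf && d.wf
  | ite _ c d => c.wf && d.wf
  | loop x b => !b.regs.contains x && b.wf

/-- A bound for the running time in terms of the number of vertices. -/
noncomputable def time : Prog → Polynomial ℕ
  | skip => .C 1
  | assign _ e => .C (1 + e.cost)
  | store _ i j e => .C (1 + i.cost + j.cost + e.cost)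
  | query _ e => .C (1 + e.cost)
  | seq c d => c.time + d.time
  | ite e c d => .C (1 + e.cost) + (c.time + d.time)
  | loop _ b => .C 2 + (.X * (b.time + .C 8) + .C 4)

/-- Apply `f 0`, …, `f (k - 1)` in turn. -/
def iter (f : ℕ → State → State) (s : State) : ℕ → State
  | 0 => s
  | k + 1 => f k (iter f s k)

section Semantics

variable {n : ℕ} (G : SimpleGraph (Fin n)) (H : Set (Fin n))

/-- The final memory. -/
noncomputable def run : Prog → State → State
  | skip, s => s
  | assign x e, s => s.setReg x (e.eval G s)
  | store a i j e, s => s.setTab a (i.eval G s) (j.eval G s) (e.eval G s)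
  | query x e, s => s.setReg x (labelBit H (e.eval G s))
  | seq c d, s => d.run (c.run s)
  | ite e c d, s => if e.eval G s = 0 then d.run s else c.run s
  | loop x b, s => (iter (fun k s' => b.run (s'.setReg x k)) s n).setReg x n

/-- The number of label queries. -/
noncomputable def queries : Prog → State → ℕ
  | skip, _ => 0
  | assign _ _, _ => 0
  | store _ _ _ _, _ => 0
  | query _ _, _ => 1
  | seq c d, s => c.queries s + d.queries (c.run G H s)
  | ite e c d, s => if e.eval G s = 0 then d.queries s else c.queries s
  | loop x b, s => ∑ k ∈ Finset.range n,
      b.queries ((iter (fun k s' => b.run G H (s'.setReg x k)) s k).setReg x k)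

end Semantics

end Prog

/-! ### Memory updates, frame rules and correctness of the translation. -/

@[simp] theorem State.setReg_reg (s : State) (x k y : ℕ) :
    (s.setReg x k).reg y = if y = x then k else s.reg y := rfl

@[simp] theorem State.setReg_tab (s : State) (x k : ℕ) : (s.setReg x k).tab = s.tab := rfl

@[simp] theorem State.setTab_reg (s : State) (a i j k : ℕ) : (s.setTab a i j k).reg = s.reg := rfl

@[simp] theorem State.setTab_tab (s : State) (a i j k a' i' j' : ℕ) :
    (s.setTab a i j k).tab a' i' j' =
      if a' = a ∧ i' = i ∧ j' = j then k else s.tab a' i' j' := rfl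

namespace Prog

variable {n : ℕ} {G : SimpleGraph (Fin n)} {H : Set (Fin n)}

theorem iter_induct {f : ℕ → State → State} {s : State} {I : ℕ → State → Prop} (h0 : I 0 s)
    (hs : ∀ (k : Fin n) s', I k s' → I (k + 1) (f k s')) : ∀ k ≤ n, I k (iter f s k)
  | 0, _ => h0
  | k + 1, hk => hs ⟨k, hk⟩ _ (iter_induct h0 hs k (by omega))

theorem run_reg {c : Prog} {x : ℕ} (hx : x ∉ c.regs) (s : State) :
    (c.run G H s).reg x = s.reg x := by
  induction c generalizing s with
  | skip => rfl
  | assign y e =>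
    simp only [regs, List.mem_singleton] at hx
    simp [run, hx]
  | store => rfl
  | query y e =>
    simp only [regs, List.mem_singleton] at hx
    simp [run, hx]
  | seq c d ihc ihd =>
    simp only [regs, List.mem_append, not_or] at hx
    rw [run, ihd hx.2, ihc hx.1]
  | ite e c d ihc ihd =>
    simp only [regs, List.mem_append, not_or] at hx
    rw [run]
    split_ifs
    · exact ihd hx.2 s
    · exact ihc hx.1 s
  | loop y b ih =>
    simp only [regs, List.mem_cons, not_or] at hx
    simp only [run, State.setReg_reg, hx.1, if_false]
    refine iter_induct (n := n) (I := fun _ s' => s'.reg x = s.reg x) rfl ?_ n le_rfl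
    intro k s' h
    rw [ih hx.2]
    simp [hx.1, h]

theorem run_tab {c : Prog} {a : ℕ} (ha : a ∉ c.tabs) (s : State) :
    (c.run G H s).tab a = s.tab a := by
  induction c generalizing s with
  | skip => rfl
  | assign y e => rfl
  | store b i j e =>
    simp only [tabs, List.mem_singleton] at ha
    funext i j
    simp [run, ha]
  | query y e => rfl
  | seq c d ihc ihd =>
    simp only [tabs, List.mem_append, not_or] at ha
    rw [run, ihd ha.2, ihc ha.1]
  | ite e c d ihc ihd =>
    simp only [tabs, List.mem_append, not_or] at ha
    rw [run]
    split_ifs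
    · exact ihd ha.2 s
    · exact ihc ha.1 s
  | loop y b ih =>
    simp only [tabs] at ha
    simp only [run, State.setReg_tab]
    refine iter_induct (n := n) (I := fun _ s' => s'.tab a = s.tab a) rfl ?_ n le_rfl
    intro k s' h
    rw [ih ha]
    simp [h]

/-- Induction on the number `m` of remaining rounds. Each costs 4 steps for the test and 4 for the
increment besides the body; the last 4 steps are the failing test, which leaves `n` in the loop
register. -/
theorem exec_while {x : ℕ} {b : Prog} (hx : x ∉ b.regs) {T : ℕ}
    (hb : ∀ s, ∃ t ≤ T, Exec G H b.compile s (b.run G H s) t (b.queries G H s))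
    (s : State) (m k : ℕ) (hmk : k + m = n) :
    ∃ t ≤ m * (T + 8) + 4, Exec G H
      (.while (.lt (.var x) .size) (.seq b.compile (.assign x (.add (.var x) (.num 1)))))
      ((iter (fun k s' => b.run G H (s'.setReg x k)) s k).setReg x k)
      ((iter (fun k s' => b.run G H (s'.setReg x k)) s n).setReg x n) t
      (∑ i ∈ Finset.Ico k n,
        b.queries G H ((iter (fun k s' => b.run G H (s'.setReg x k)) s i).setReg x i)) := by
  induction m generalizing k with
  | zero =>
    obtain rfl : k = n := by omega
    refine ⟨4, by omega, ?_⟩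
    rw [Finset.Ico_self, Finset.sum_empty]
    exact Exec.while_false (by simp [Expr.eval])
  | succ m ih =>
    obtain ⟨t, ht, h⟩ := ih (k + 1) (by omega)
    obtain ⟨t', ht', h'⟩ := hb ((iter (fun k s' => b.run G H (s'.setReg x k)) s k).setReg x k)
    refine ⟨1 + (Expr.lt (.var x) .size).cost + (t' + (1 + (Expr.add (.var x) (.num 1)).cost)) + t,
      ?_, ?_⟩
    · simp only [Expr.cost]
      have : (m + 1) * (T + 8) = m * (T + 8) + (T + 8) := by ring
      omega
    · rw [Finset.sum_eq_sum_Ico_succ_bot (by omega : k < n)]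
      have hassign := Exec.assign (G := G) (H := H) x (.add (.var x) (.num 1))
        (b.run G H ((iter (fun k s' => b.run G H (s'.setReg x k)) s k).setReg x k))
      have hv : (Expr.add (.var x) (.num 1)).eval G
          (b.run G H ((iter (fun k s' => b.run G H (s'.setReg x k)) s k).setReg x k)) = k + 1 := by
        simp [Expr.eval, run_reg hx]
      rw [hv] at hassign
      refine Exec.while_true ?_ (Exec.seq h' hassign) h
      have : k < n := by omega
      simp [Expr.eval, this]

theorem exec_compile {c : Prog} (hc : c.wf = true) (s : State) :
    ∃ t ≤ c.time.eval n, Exec G H c.compile s (c.run G H s) t (c.queries G H s) := by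
  induction c generalizing s with
  | skip => exact ⟨1, by simp [time], .skip s⟩
  | assign x e => exact ⟨_, by simp [time], .assign x e s⟩
  | store a i j e => exact ⟨_, by simp [time], .store a i j e s⟩
  | query x e => exact ⟨_, by simp [time], .query x e s⟩
  | seq c d ihc ihd =>
    simp only [wf, Bool.and_eq_true] at hc
    obtain ⟨t, ht, h⟩ := ihc hc.1 s
    obtain ⟨t', ht', h'⟩ := ihd hc.2 (c.run G H s)
    refine ⟨t + t', ?_, .seq h h'⟩
    rw [time, Polynomial.eval_add]
    omega
  | ite e c d ihc ihd =>
    simp only [wf, Bool.and_eq_true] at hc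
    simp only [time, Polynomial.eval_add, Polynomial.eval_C, run, queries]
    split_ifs with he
    · obtain ⟨t, ht, h⟩ := ihd hc.2 s
      exact ⟨1 + e.cost + t, by omega, .ite_false he h⟩
    · obtain ⟨t, ht, h⟩ := ihc hc.1 s
      exact ⟨1 + e.cost + t, by omega, .ite_true he h⟩
  | loop x b ih =>
    simp only [wf, Bool.and_eq_true, Bool.not_eq_true', List.contains_eq_mem,
      decide_eq_false_iff_not] at hc
    obtain ⟨t, ht, h⟩ := exec_while (G := G) (H := H) hc.1 (ih hc.2) s n 0 (by omega)
    refine ⟨2 + t, ?_, ?_⟩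
    · simp only [time, Polynomial.eval_add, Polynomial.eval_C, Polynomial.eval_mul,
        Polynomial.eval_X]
      omega
    · rw [Nat.Ico_zero_eq_range] at h
      have := Exec.seq (Exec.assign (G := G) (H := H) x (.num 0) s) h
      rw [zero_add] at this
      exact this

/-! ### Rules for loops -/

theorem run_seq (c d : Prog) (s : State) : (seq c d).run G H s = d.run G H (c.run G H s) := rfl

theorem queries_eq_zero {c : Prog} (hc : ∀ s, c.queries G H s = 0) (x : ℕ) (s : State) :
    (loop x c).queries G H s = 0 :=
  Finset.sum_eq_zero fun _ _ => hc _

theorem loop_induct {x : ℕ} {b : Prog} {s : State} (I : ℕ → State → Prop) (h0 : I 0 s)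
    (hs : ∀ (k : Fin n) s', I k s' → I (k + 1) (b.run G H (s'.setReg x k)))
    (hn : ∀ s', I n s' → I n (s'.setReg x n)) : I n ((loop x b).run G H s) :=
  hn _ (iter_induct (n := n) h0 hs n le_rfl)

/-- `I k s q`: an invariant for the memory `s` after `k` rounds with `q` queries in total. -/
theorem loop_induct_queries {x : ℕ} {b : Prog} {s : State} (I : ℕ → State → ℕ → Prop)
    (h0 : I 0 s 0)
    (hs : ∀ (k : Fin n) s' q, I k s' q →
      I (k + 1) (b.run G H (s'.setReg x k)) (q + b.queries G H (s'.setReg x k)))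
    (hn : ∀ s' q, I n s' q → I n (s'.setReg x n) q) :
    I n ((loop x b).run G H s) ((loop x b).queries G H s) := by
  refine hn _ _ ?_
  have : ∀ k ≤ n, I k (iter (fun k s' => b.run G H (s'.setReg x k)) s k)
      (∑ i ∈ Finset.range k,
        b.queries G H ((iter (fun k s' => b.run G H (s'.setReg x k)) s i).setReg x i)) := by
    intro k
    induction k with
    | zero => exact fun _ => h0
    | succ k ih =>
      intro hk
      rw [Finset.sum_range_succ]
      exact hs ⟨k, hk⟩ _ _ (ih (by omega))
  exact this n le_rfl

/-- For loops whose rounds may come in any order: `R` is a preorder recording what every round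
preserves, and `D k` is a goal reached in round `k` that cannot be undone along `R`. -/
theorem loop_all {x : ℕ} {b : Prog} {s : State} (R : State → State → Prop) (hrefl : ∀ s, R s s)
    (htrans : ∀ s₁ s₂ s₃, R s₁ s₂ → R s₂ s₃ → R s₁ s₃) (hset : ∀ s k, R s (s.setReg x k))
    (D : Fin n → State → Prop) (hD : ∀ k s s', R s s' → D k s → D k s')
    (hb : ∀ (k : Fin n) s', R s s' → s'.reg x = k →
      R s' (b.run G H s') ∧ D k (b.run G H s')) :
    R s ((loop x b).run G H s) ∧ ∀ k, D k ((loop x b).run G H s) := by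
  have key := loop_induct (G := G) (H := H) (x := x) (b := b) (s := s)
    (fun m s' => R s s' ∧ ∀ k : Fin n, (k : ℕ) < m → D k s') ⟨hrefl s, by simp⟩ ?_ ?_
  · exact ⟨key.1, fun k => key.2 k k.2⟩
  · rintro k s' ⟨h1, h2⟩
    have h3 := htrans _ _ _ h1 (hset s' k)
    obtain ⟨h4, h5⟩ := hb k _ h3 (by simp)
    refine ⟨htrans _ _ _ h3 h4, fun j hj => ?_⟩
    rcases Nat.lt_succ_iff_lt_or_eq.1 hj with hj | hj
    · exact hD _ _ _ (htrans _ _ _ (hset s' k) h4) (h2 j hj)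
    · rwa [Fin.ext hj]
  · rintro s' ⟨h1, h2⟩
    exact ⟨htrans _ _ _ h1 (hset _ _), fun k hk => hD _ _ _ (hset _ _) (h2 k hk)⟩

theorem loop_all₂ {x y : ℕ} {b : Prog} {s : State} (hxy : x ≠ y)
    (hx : x ∉ b.regs) (R : State → State → Prop) (hrefl : ∀ s, R s s)
    (htrans : ∀ s₁ s₂ s₃, R s₁ s₂ → R s₂ s₃ → R s₁ s₃)
    (hset : ∀ s z k, z = x ∨ z = y → R s (s.setReg z k))
    (D : Fin n → Fin n → State → Prop) (hD : ∀ i j s s', R s s' → D i j s → D i j s')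
    (hb : ∀ (i j : Fin n) s', R s s' → s'.reg x = i → s'.reg y = j →
      R s' (b.run G H s') ∧ D i j (b.run G H s')) :
    R s ((loop x (loop y b)).run G H s) ∧ ∀ i j, D i j ((loop x (loop y b)).run G H s) := by
  refine loop_all R hrefl htrans (fun s k => hset s x k (.inl rfl)) (fun i s => ∀ j, D i j s)
    (fun i s s' h h' j => hD i j s s' h (h' j)) fun i s' h hi => ?_
  have := loop_all (G := G) (H := H) (x := y) (b := b) (s := s')
    (fun s s' => R s s' ∧ s'.reg x = s.reg x) (fun s => ⟨hrefl s, rfl⟩)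
    (fun s₁ s₂ s₃ h h' => ⟨htrans _ _ _ h.1 h'.1, h'.2.trans h.2⟩)
    (fun s k => ⟨hset s y k (.inr rfl), by simp [hxy]⟩) (D i)
    (fun j s s' h => hD i j s s' h.1) fun j s'' h' hj => ?_
  · exact ⟨this.1.1, this.2⟩
  · obtain ⟨h1, h2⟩ := hb i j s'' (htrans _ _ _ h h'.1) (h'.2.trans hi) hj
    exact ⟨⟨h1, run_reg hx _⟩, h2⟩

theorem loop_all₃ {x y z : ℕ} {b : Prog} {s : State} (hxy : x ≠ y) (hxz : x ≠ z) (hyz : y ≠ z)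
    (hx : x ∉ b.regs) (hy : y ∉ b.regs) (R : State → State → Prop) (hrefl : ∀ s, R s s)
    (htrans : ∀ s₁ s₂ s₃, R s₁ s₂ → R s₂ s₃ → R s₁ s₃)
    (hset : ∀ s u k, u = x ∨ u = y ∨ u = z → R s (s.setReg u k))
    (D : Fin n → Fin n → Fin n → State → Prop)
    (hD : ∀ i j k s s', R s s' → D i j k s → D i j k s')
    (hb : ∀ (i j k : Fin n) s', R s s' → s'.reg x = i → s'.reg y = j → s'.reg z = k →
      R s' (b.run G H s') ∧ D i j k (b.run G H s')) :
    R s ((loop x (loop y (loop z b))).run G H s) ∧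
      ∀ i j k, D i j k ((loop x (loop y (loop z b))).run G H s) := by
  refine loop_all R hrefl htrans (fun s k => hset s x k (.inl rfl)) (fun i s => ∀ j k, D i j k s)
    (fun i s s' h h' j k => hD i j k s s' h (h' j k)) fun i s' h hi => ?_
  have := loop_all₂ (G := G) (H := H) (x := y) (y := z) (b := b) (s := s') hyz hy
    (fun s s' => R s s' ∧ s'.reg x = s.reg x) (fun s => ⟨hrefl s, rfl⟩)
    (fun s₁ s₂ s₃ h h' => ⟨htrans _ _ _ h.1 h'.1, h'.2.trans h.2⟩)
    (fun s u k hu => ⟨hset s u k (.inr hu), by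
      have : x ≠ u := by rcases hu with rfl | rfl <;> assumption
      simp [this]⟩) (D i)
    (fun j k s s' h => hD i j k s s' h.1) fun j k s'' h' hj hk => ?_
  · exact ⟨this.1.1, this.2⟩
  · obtain ⟨h1, h2⟩ := hb i j k s'' (htrans _ _ _ h h'.1) (h'.2.trans hi) hj hk
    exact ⟨⟨h1, run_reg hx _⟩, h2⟩

/-- Run `c` if all expressions in the list are nonzero. -/
def guarded (es : List Expr) (c : Prog) : Prog :=
  es.foldr (fun e d => ite e d skip) c

open Classical in
theorem run_guarded (es : List Expr) (c : Prog) (s : State) :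
    (guarded es c).run G H s = if ∀ e ∈ es, e.eval G s ≠ 0 then c.run G H s else s := by
  induction es with
  | nil => simp [guarded]
  | cons e es ih =>
    have : (guarded (e :: es) c).run G H s =
      if e.eval G s = 0 then s else (guarded es c).run G H s := rfl
    rw [this, ih]
    by_cases h : e.eval G s = 0 <;> simp [h]

/-- A program without query instructions. -/
def silent : Prog → Bool
  | query _ _ => false
  | seq c d => c.silent && d.silent
  | ite _ c d => c.silent && d.silent
  | loop _ b => b.silent
  | _ => true

theorem queries_of_silent {c : Prog} (hc : c.silent = true) (s : State) : c.queries G H s = 0 := by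
  induction c generalizing s with
  | query => simp [silent] at hc
  | seq c d ihc ihd =>
    simp only [silent, Bool.and_eq_true] at hc
    simp [queries, ihc hc.1, ihd hc.2]
  | ite e c d ihc ihd =>
    simp only [silent, Bool.and_eq_true] at hc
    simp [queries, ihc hc.1, ihd hc.2]
  | loop x b ih => exact queries_eq_zero (ih hc) x s
  | _ => rfl

end Prog

@[simp] theorem adjBit_fin {n : ℕ} (G : SimpleGraph (Fin n)) [DecidableRel G.Adj] (i j : Fin n) :
    adjBit G i j = if G.Adj i j then 1 else 0 := by
  unfold adjBit
  by_cases h : G.Adj i j <;> simp [h]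

open Classical in
@[simp] theorem labelBit_fin {n : ℕ} (H : Set (Fin n)) (i : Fin n) :
    labelBit H i = if i ∈ H then 1 else 0 := by
  unfold labelBit
  simp

/-! ### Least fixed points by bounded iteration -/

section FixedPoint

variable {α : Type*}

/-- `X` arises from `X₀` by sound applications of `step`, and is closed or has at least `k`
elements. -/
def Approx (step : Set α → Set α) (X₀ : Set α) (k : ℕ) (X : Set α) : Prop :=
  X₀ ⊆ X ∧ (∀ C, step C ⊆ C → X₀ ⊆ C → X ⊆ C) ∧ (step X ⊆ X ∨ k ≤ X.ncard)

theorem Approx.zero (step : Set α → Set α) (X₀ : Set α) : Approx step X₀ 0 X₀ :=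
  ⟨subset_rfl, fun _ _ h => h, by simp⟩

/-- Rounds may update in place, so `X'` need not be `X ∪ step X`. It suffices that it contains both
and lies in every closed set above `X`: then it equals `X` if `X` is closed, and is strictly larger
otherwise. -/
theorem Approx.succ [Finite α] {step : Set α → Set α} {X₀ X X' : Set α} {k : ℕ} (h : Approx step X₀ k X)
    (h1 : X ⊆ X') (h2 : step X ⊆ X') (h3 : ∀ C, step C ⊆ C → X ⊆ C → X' ⊆ C) :
    Approx step X₀ (k + 1) X' := by
  refine ⟨h.1.trans h1, fun C hC hX => h3 C hC (h.2.1 C hC hX), ?_⟩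
  by_cases hX : step X ⊆ X
  · have : X' = X := (h3 X hX subset_rfl).antisymm h1
    exact .inl (this ▸ hX)
  · right
    have hlt := Set.ncard_lt_ncard (h1.ssubset_of_ne (by rintro rfl; exact hX h2))
      (Set.toFinite X')
    have := h.2.2.resolve_left hX
    omega

theorem Approx.closed [Finite α] {step : Set α → Set α} {X₀ X : Set α} {k : ℕ} (h : Approx step X₀ k X)
    (hk : Nat.card α ≤ k) : step X ⊆ X := by
  rcases h.2.2 with h | h
  · exact h
  · have : X = Set.univ := Set.eq_of_subset_of_ncard_le (Set.subset_univ X)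
      (by rw [Set.ncard_univ]; exact hk.trans h)
    rw [this]
    exact Set.subset_univ _

end FixedPoint

open Prog

/-! ### Distances -/

/-- Negation of a truth value. -/
def Expr.not (e : Expr) : Expr := .eq e (.num 0)

@[simp] theorem Expr.eval_not {n : ℕ} (G : SimpleGraph (Fin n)) (s : State) (e : Expr) :
    e.not.eval G s = if e.eval G s = 0 then 1 else 0 := rfl

/-- One relaxation step of breadth-first search. -/
def distLeaf : Prog :=
  guarded [.eq (.cell 3 (.var 0) (.var 2)) (.add (.var 3) (.num 1)), .adj (.var 2) (.var 1),
    .not (.cell 3 (.var 0) (.var 1))] (store 3 (.var 0) (.var 1) (.add (.var 3) (.num 2)))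

/-- Fill table `3` with the distances plus one. -/
def distProg : Prog :=
  seq (loop 0 (store 3 (.var 0) (.var 0) (.num 1)))
    (loop 3 (loop 0 (loop 1 (loop 2 distLeaf))))

section

variable {n : ℕ} {G : SimpleGraph (Fin n)} {H : Set (Fin n)}

theorem dist_lt_card (hG : G.Connected) (i j : Fin n) : G.dist i j < n := by
  obtain ⟨p, hp, hl⟩ := hG.exists_path_of_dist i j
  have := hp.length_lt
  rw [Fintype.card_fin] at this
  omega

theorem exists_adj_of_dist_eq_succ (hG : G.Connected) {i j : Fin n} {k : ℕ}
    (h : G.dist i j = k + 1) : ∃ l, G.dist i l = k ∧ G.Adj l j := by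
  obtain ⟨l, h1, h2⟩ := exists_dist_eq hG i j (k := k) (by omega)
  exact ⟨l, h1, SimpleGraph.dist_eq_one_iff_adj.1 (by omega)⟩

/-- The table of distances in the course of round `k`. -/
def DistMid (G : SimpleGraph (Fin n)) (k : ℕ) (s : State) : Prop :=
  ∀ i j : Fin n, (G.dist i j ≤ k → s.tab 3 i j = G.dist i j + 1) ∧
    (G.dist i j = k + 1 → s.tab 3 i j = 0 ∨ s.tab 3 i j = k + 2) ∧
    (k + 1 < G.dist i j → s.tab 3 i j = 0)

/-- The three parts are invariance, persistence of filled entries, and progress. New entries get the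
value `k + 2`, so the test for `k + 1` never picks up a vertex discovered in the current round. -/
theorem run_distLeaf (hG : G.Connected) {k : ℕ} {s : State} (hs : DistMid G k s) {i j l : Fin n}
    (h3 : s.reg 3 = k) (h0 : s.reg 0 = i) (h1 : s.reg 1 = j) (h2 : s.reg 2 = l) :
    DistMid G k (distLeaf.run G H s) ∧
      (∀ i j : Fin n, s.tab 3 i j ≠ 0 → (distLeaf.run G H s).tab 3 i j ≠ 0) ∧
      (G.dist i l = k → G.Adj l j → (distLeaf.run G H s).tab 3 i j ≠ 0) := by
  classical
  rw [distLeaf, run_guarded]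
  split_ifs with h
  · simp [Expr.eval, h0, h1, h2, h3] at h
    obtain ⟨ha, hb, hc⟩ := h
    have hil : G.dist i l = k := by
      have := hs i l
      rcases lt_trichotomy (G.dist i l) (k + 1) with h | h | h
      · have := this.1 (by omega)
        omega
      · have := this.2.1 h
        omega
      · have := this.2.2 h
        omega
    have hij : G.dist i j = k + 1 := by
      have h1 := hG.dist_triangle (u := i) (v := l) (w := j)
      rw [SimpleGraph.dist_eq_one_iff_adj.2 hb] at h1
      by_contra hne
      have := (hs i j).1 (by omega)
      omega
    refine ⟨fun i' j' => ?_, fun i' j' hn => ?_, fun _ _ => ?_⟩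
    · by_cases he : i' = i ∧ j' = j
      · obtain ⟨rfl, rfl⟩ := he
        simp [run, Expr.eval, h0, h1, h3, hij]
      · have he' : ¬ ((i' : ℕ) = i ∧ (j' : ℕ) = j) := by simpa [Fin.ext_iff] using he
        simpa [run, Expr.eval, h0, h1, he'] using hs i' j'
    · simp only [run, Expr.eval, State.setTab_tab]
      split_ifs
      · omega
      · exact hn
    · simp [run, Expr.eval, h0, h1]
  · refine ⟨hs, fun _ _ h => h, fun hd hadj hz => h ?_⟩
    simp [Expr.eval, h0, h1, h2, h3, hz, hadj, (hs i l).1 hd.le, hd]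

theorem run_distProg (hG : G.Connected) {s : State} (hs : ∀ i j, s.tab 3 i j = 0) (i j : Fin n) :
    (distProg.run G H s).tab 3 i j = G.dist i j + 1 := by
  have hinit := loop_induct (G := G) (H := H) (x := 0)
    (b := store 3 (.var 0) (.var 0) (.num 1)) (s := s)
    (fun m s' => ∀ i j : Fin n, s'.tab 3 i j = if i = j ∧ (i : ℕ) < m then 1 else 0)
    (by simp [hs]) (by
      intro k s' ih i j
      simp only [run, Expr.eval, State.setTab_tab, State.setReg_reg, State.setReg_tab, ih,
        if_true, true_and]
      have h1 : ((i : ℕ) = k ∧ (j : ℕ) = k) ↔ (i = j ∧ (i : ℕ) = k) := by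
        rw [Fin.ext_iff]; omega
      rw [if_congr h1 rfl rfl]
      split_ifs <;> first | rfl | omega) (fun _ h => h)
  set s₁ := (loop 0 (store 3 (.var 0) (.var 0) (.num 1))).run G H s
  have hrounds := loop_induct (G := G) (H := H) (x := 3)
    (b := loop 0 (loop 1 (loop 2 distLeaf))) (s := s₁)
    (fun m s' => ∀ i j : Fin n, s'.tab 3 i j = if G.dist i j ≤ m then G.dist i j + 1 else 0)
    (by
      intro i j
      rw [hinit]
      by_cases h : i = j
      · simp [h]
      · have := hG.pos_dist_of_ne h
        simp [h, this.ne'])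
    (by
      intro m s' ih
      have hmid : DistMid G m (s'.setReg 3 m) := by
        intro i j
        simp only [State.setReg_tab, ih]
        refine ⟨fun h => by simp [h], fun h => .inl (by simp [h]), fun h => ?_⟩
        rw [if_neg (by omega)]
      obtain ⟨⟨h1, -⟩, h2⟩ := loop_all₃ (G := G) (H := H) (x := 0) (y := 1) (z := 2)
        (b := distLeaf) (s := s'.setReg 3 m) (by decide) (by decide) (by decide) (by decide)
        (by decide)
        (fun s s' => (s.reg 3 = m ∧ DistMid G m s → s'.reg 3 = m ∧ DistMid G m s') ∧
          (s.reg 3 = m ∧ DistMid G m s → ∀ i j : Fin n, s.tab 3 i j ≠ 0 → s'.tab 3 i j ≠ 0))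
        (fun s => ⟨id, fun _ _ _ h => h⟩)
        (fun s₁ s₂ s₃ h h' => ⟨h'.1 ∘ h.1, fun hs i j hij => h'.2 (h.1 hs) i j (h.2 hs i j hij)⟩)
        (fun s u k hu => ⟨fun h => ⟨by rcases hu with rfl | rfl | rfl <;> simpa using h.1, h.2⟩,
          fun _ _ _ h => h⟩)
        (fun i j l s => s.reg 3 = m ∧ DistMid G m s ∧
          (G.dist i l = m → G.Adj l j → s.tab 3 i j ≠ 0))
        (fun i j l s s' h h' => ⟨(h.1 ⟨h'.1, h'.2.1⟩).1, (h.1 ⟨h'.1, h'.2.1⟩).2,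
          fun ha hb => h.2 ⟨h'.1, h'.2.1⟩ i j (h'.2.2 ha hb)⟩)
        (by
          intro i j l s'' hR h0 h1 h2
          have hpre := hR.1 ⟨by simp, hmid⟩
          have hleaf := run_distLeaf (H := H) hG hpre.2 hpre.1 h0 h1 h2
          have hreg : (distLeaf.run G H s'').reg 3 = m := by
            rw [run_reg (by decide)]; exact hpre.1
          exact ⟨⟨fun _ => ⟨hreg, hleaf.1⟩, fun _ => hleaf.2.1⟩, hreg, hleaf.1, hleaf.2.2⟩)
      have h1 := (h1 ⟨by simp, hmid⟩).2
      intro i j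
      rcases lt_trichotomy (G.dist i j) (m + 1) with h | h | h
      · rw [(h1 i j).1 (by omega), if_pos (by omega)]
      · obtain ⟨l, hl, hlj⟩ := exists_adj_of_dist_eq_succ hG h
        rw [((h1 i j).2.1 h).resolve_left ((h2 i j l).2.2 hl hlj), if_pos (by omega)]
        omega
      · rw [(h1 i j).2.2 h, if_neg (by omega)])
    (fun _ h => h)
  have := hrounds i j
  rwa [if_pos (dist_lt_card hG i j).le] at this

/-! ### The convex hull -/

/-- The one-step consequences `hullStep` for given vertices. -/
def hullLeaf : Prog :=
  seq (guarded [.cell 2 (.var 1) (.var 1), .not (.adj (.var 0) (.var 1)),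
      .not (.eq (.var 1) (.var 0))] (store 2 (.var 0) (.var 1) (.num 1)))
  (seq (guarded [.cell 2 (.var 0) (.var 1), .not (.adj (.var 0) (.var 1)),
      .not (.eq (.var 1) (.var 0)), .not (.adj (.var 0) (.var 2)), .not (.eq (.var 2) (.var 0)),
      .adj (.var 1) (.var 2)] (store 2 (.var 0) (.var 2) (.num 1)))
  (guarded [.cell 2 (.var 0) (.var 0), .cell 2 (.var 0) (.var 1), .not (.adj (.var 0) (.var 1)),
      .not (.eq (.var 1) (.var 0)), .adj (.var 0) (.var 2), .adj (.var 1) (.var 2)]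
    (store 2 (.var 2) (.var 2) (.num 1))))

/-- Decide whether the set in table `1` without the vertex in register `4` is a hull set, and
write the answer to register `7`. -/
def hullProg : Prog :=
  seq (loop 0 (loop 1 (store 2 (.var 0) (.var 1) (.num 0))))
  (seq (loop 0 (guarded [.cell 1 (.var 0) (.num 0), .not (.eq (.var 0) (.var 4))]
      (store 2 (.var 0) (.var 0) (.num 1))))
  (seq (loop 5 (loop 6 (loop 0 (loop 1 (loop 2 hullLeaf)))))
  (seq (assign 7 (.num 1))
  (loop 0 (guarded [.not (.cell 2 (.var 0) (.var 0))] (assign 7 (.num 0)))))))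

/-- The pairs marked in table `2`. -/
def pairs (n : ℕ) (s : State) : Set (Fin n × Fin n) := {c | s.tab 2 c.1 c.2 ≠ 0}

open Classical in
theorem pairs_guarded_store (es : List Expr) (e f : Expr) (s : State) {u w : Fin n}
    (he : e.eval G s = u) (hf : f.eval G s = w) :
    pairs n ((guarded es (store 2 e f (.num 1))).run G H s) =
      pairs n s ∪ {c | (∀ e ∈ es, e.eval G s ≠ 0) ∧ c = (u, w)} := by
  rw [run_guarded]
  ext ⟨i, j⟩
  split_ifs with h
  · by_cases hc : i = u ∧ j = w
    · obtain ⟨rfl, rfl⟩ := hc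
      exact iff_of_true (by simp [pairs, run, Expr.eval, he, hf]) (.inr ⟨h, rfl⟩)
    · have hc' : ¬ ((i : ℕ) = u ∧ (j : ℕ) = w) := by simpa [Fin.ext_iff] using hc
      simp [pairs, run, he, hf, hc, hc']
  · simp [pairs, h]

theorem run_hullLeaf {s : State} {u y w : Fin n} (h0 : s.reg 0 = u) (h1 : s.reg 1 = y)
    (h2 : s.reg 2 = w) :
    (pairs n s ⊆ pairs n (hullLeaf.run G H s) ∧
      ∀ C, hullStep G C ⊆ C → pairs n s ⊆ C → pairs n (hullLeaf.run G H s) ⊆ C) ∧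
    (((y, y) ∈ pairs n s → Far G u y → (u, y) ∈ pairs n (hullLeaf.run G H s)) ∧
      ((u, y) ∈ pairs n s → Far G u y → Far G u w → G.Adj y w →
        (u, w) ∈ pairs n (hullLeaf.run G H s)) ∧
      ((u, u) ∈ pairs n s → (u, y) ∈ pairs n s → Far G u y → G.Adj u w → G.Adj y w →
        (w, w) ∈ pairs n (hullLeaf.run G H s))) := by
  classical
  rw [hullLeaf, run_seq, run_seq]
  set s₁ := run G H (guarded [.cell 2 (.var 1) (.var 1), .not (.adj (.var 0) (.var 1)),
      .not (.eq (.var 1) (.var 0))] (store 2 (.var 0) (.var 1) (.num 1))) s with hs₁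
  have p1 : pairs n s₁ = pairs n s ∪ {c | ((y, y) ∈ pairs n s ∧ Far G u y) ∧ c = (u, y)} := by
    rw [hs₁, pairs_guarded_store (u := u) (w := y) _ (.var 0) (.var 1) _ h0 h1]
    simp [Expr.eval, h0, h1, pairs, Far, Fin.ext_iff]
  have r0 : s₁.reg 0 = u := by rw [hs₁, run_reg (by decide), h0]
  have r1 : s₁.reg 1 = y := by rw [hs₁, run_reg (by decide), h1]
  have r2 : s₁.reg 2 = w := by rw [hs₁, run_reg (by decide), h2]
  set s₂ := run G H (guarded [.cell 2 (.var 0) (.var 1), .not (.adj (.var 0) (.var 1)),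
      .not (.eq (.var 1) (.var 0)), .not (.adj (.var 0) (.var 2)), .not (.eq (.var 2) (.var 0)),
      .adj (.var 1) (.var 2)] (store 2 (.var 0) (.var 2) (.num 1))) s₁ with hs₂
  have p2 : pairs n s₂ = pairs n s₁ ∪
      {c | ((u, y) ∈ pairs n s₁ ∧ Far G u y ∧ Far G u w ∧ G.Adj y w) ∧ c = (u, w)} := by
    rw [hs₂, pairs_guarded_store (u := u) (w := w) _ (.var 0) (.var 2) _ r0 r2]
    simp [Expr.eval, r0, r1, r2, pairs, Far, Fin.ext_iff, and_assoc]
  have t0 : s₂.reg 0 = u := by rw [hs₂, run_reg (by decide), r0]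
  have t1 : s₂.reg 1 = y := by rw [hs₂, run_reg (by decide), r1]
  have t2 : s₂.reg 2 = w := by rw [hs₂, run_reg (by decide), r2]
  have p3 := pairs_guarded_store (G := G) (H := H) (u := w) (w := w)
    [.cell 2 (.var 0) (.var 0), .cell 2 (.var 0) (.var 1), .not (.adj (.var 0) (.var 1)),
      .not (.eq (.var 1) (.var 0)), .adj (.var 0) (.var 2), .adj (.var 1) (.var 2)]
    (.var 2) (.var 2) s₂ t2 t2
  generalize run G H _ s₂ = s₃ at p3 ⊢
  replace p3 : pairs n s₃ = pairs n s₂ ∪ {c | ((u, u) ∈ pairs n s₂ ∧ (u, y) ∈ pairs n s₂ ∧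
      Far G u y ∧ G.Adj u w ∧ G.Adj y w) ∧ c = (w, w)} := by
    rw [p3]
    simp [Expr.eval, t0, t1, t2, pairs, Far, Fin.ext_iff, and_assoc]
  have q1 : pairs n s ⊆ pairs n s₁ := by rw [p1]; exact Set.subset_union_left
  have q2 : pairs n s₁ ⊆ pairs n s₂ := by rw [p2]; exact Set.subset_union_left
  have q3 : pairs n s₂ ⊆ pairs n s₃ := by rw [p3]; exact Set.subset_union_left
  refine ⟨⟨q1.trans (q2.trans q3), fun C hC hX => ?_⟩, fun a b => ?_, fun a b c d => ?_,
    fun a b c d e => ?_⟩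
  · have c1 : pairs n s₁ ⊆ C := by
      rw [p1]
      refine Set.union_subset hX ?_
      rintro _ ⟨⟨a, b⟩, rfl⟩
      exact hC ⟨u, y, w, .inl ⟨hX a, b, rfl⟩⟩
    have c2 : pairs n s₂ ⊆ C := by
      rw [p2]
      refine Set.union_subset c1 ?_
      rintro _ ⟨⟨a, b, c, d⟩, rfl⟩
      exact hC ⟨u, y, w, .inr (.inl ⟨c1 a, b, c, d, rfl⟩)⟩
    rw [p3]
    refine Set.union_subset c2 ?_
    rintro _ ⟨⟨a, b, c, d, e⟩, rfl⟩
    exact hC ⟨u, y, w, .inr (.inr ⟨c2 a, c2 b, c, d, e, rfl⟩)⟩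
  · apply q3; apply q2
    rw [p1]
    exact .inr ⟨⟨a, b⟩, rfl⟩
  · apply q3
    rw [p2]
    exact .inr ⟨⟨q1 a, b, c, d⟩, rfl⟩
  · rw [p3]
    exact .inr ⟨⟨q2 (q1 a), q2 (q1 b), c, d, e⟩, rfl⟩

theorem approx_hullRound {X₀ : Set (Fin n × Fin n)} {k : ℕ} {s : State}
    (h : Approx (hullStep G) X₀ k (pairs n s)) :
    Approx (hullStep G) X₀ (k + 1)
      (pairs n ((loop 0 (loop 1 (loop 2 hullLeaf))).run G H s)) := by
  obtain ⟨h1, h2⟩ := loop_all₃ (G := G) (H := H) (x := 0) (y := 1) (z := 2) (b := hullLeaf) (s := s)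
    (by decide) (by decide) (by decide) (by decide) (by decide)
    (fun s s' => pairs n s ⊆ pairs n s' ∧
      ∀ C, hullStep G C ⊆ C → pairs n s ⊆ C → pairs n s' ⊆ C)
    (fun s => ⟨subset_rfl, fun _ _ h => h⟩)
    (fun s₁ s₂ s₃ h h' => ⟨h.1.trans h'.1, fun C hC hX => h'.2 C hC (h.2 C hC hX)⟩)
    (fun s u k _ => ⟨subset_rfl, fun _ _ h => h⟩)
    (fun u y w s' => ((y, y) ∈ pairs n s → Far G u y → (u, y) ∈ pairs n s') ∧
      ((u, y) ∈ pairs n s → Far G u y → Far G u w → G.Adj y w → (u, w) ∈ pairs n s') ∧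
      ((u, u) ∈ pairs n s → (u, y) ∈ pairs n s → Far G u y → G.Adj u w → G.Adj y w →
        (w, w) ∈ pairs n s'))
    (fun u y w s s' h h' => ⟨fun a b => h.1 (h'.1 a b), fun a b c d => h.1 (h'.2.1 a b c d),
      fun a b c d e => h.1 (h'.2.2 a b c d e)⟩)
    (fun u y w s' hR h0 h1 h2 => by
      obtain ⟨ha, hb, hc, hd⟩ := run_hullLeaf (G := G) (H := H) h0 h1 h2
      exact ⟨ha, fun a => hb (hR.1 a), fun a => hc (hR.1 a), fun a b => hd (hR.1 a) (hR.1 b)⟩)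
  refine h.succ h1.1 ?_ h1.2
  rintro _ ⟨u, y, w, ⟨a, b, rfl⟩ | ⟨a, b, c, d, rfl⟩ | ⟨a, b, c, d, e, rfl⟩⟩
  · exact (h2 u y w).1 a b
  · exact (h2 u y w).2.1 a b c d
  · exact (h2 u y w).2.2 a b c d e

/-- There are `n * n` pairs in all, so that many rounds force closedness by `Approx.closed`, with no
test for stabilisation. -/
theorem approx_hullRounds (s : State) :
    Approx (hullStep G) (pairs n s) (n * n)
      (pairs n ((loop 5 (loop 6 (loop 0 (loop 1 (loop 2 hullLeaf))))).run G H s)) := by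
  refine loop_induct (fun k s' => Approx (hullStep G) (pairs n s) (k * n) (pairs n s')) ?_ ?_
    (fun _ h => h)
  · rw [zero_mul]
    exact .zero _ _
  · intro k s' h
    rw [add_mul, one_mul]
    refine loop_induct (fun m s' => Approx (hullStep G) (pairs n s) (k * n + m) (pairs n s')) h ?_
      (fun _ h => h)
    exact fun m s'' h => approx_hullRound h

/-- The set of vertices marked in column `0` of table `a`. -/
def marked (n a : ℕ) (s : State) : Set (Fin n) := {v | s.tab a v 0 ≠ 0}

open Classical in
theorem run_hullProg {s : State} {x : Fin n} (hx : s.reg 4 = x) :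
    (hullProg.run G H s).reg 7 = if mHull G (marked n 1 s \ {x}) = Set.univ then 1 else 0 := by
  rw [hullProg, run_seq, run_seq, run_seq, run_seq]
  -- Table `2` still holds the pairs of the previous hull computation and must be erased.
  have hclear := (loop_all₂ (G := G) (H := H) (x := 0) (y := 1)
    (b := store 2 (.var 0) (.var 1) (.num 0)) (s := s) (by decide) (by decide)
    (fun s s' => ∀ i j : Fin n, s.tab 2 i j = 0 → s'.tab 2 i j = 0) (fun _ _ _ h => h)
    (fun _ _ _ h h' i j hij => h' i j (h i j hij)) (fun _ _ _ _ _ _ h => h)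
    (fun i j s => s.tab 2 i j = 0) (fun i j s s' h => h i j)
    (fun i j s' _ h0 h1 => by
      refine ⟨fun i j hij => ?_, by simp [run, Expr.eval, h0, h1]⟩
      simp only [run, Expr.eval, State.setTab_tab, hij, ite_self])).2
  have hx₁ : (run G H (loop 0 (loop 1 (store 2 (.var 0) (.var 1) (.num 0)))) s).reg 4 = x := by
    rw [run_reg (by decide), hx]
  have hm₁ : marked n 1 (run G H (loop 0 (loop 1 (store 2 (.var 0) (.var 1) (.num 0)))) s) =
      marked n 1 s := by
    simp only [marked, run_tab (c := loop 0 (loop 1 (store 2 (.var 0) (.var 1) (.num 0))))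
      (a := 1) (by decide)]
  generalize run G H (loop 0 (loop 1 (store 2 (.var 0) (.var 1) (.num 0)))) s = s₁ at *
  rw [← hm₁]
  have hinit := loop_induct (G := G) (H := H) (x := 0)
    (b := guarded [.cell 1 (.var 0) (.num 0), .not (.eq (.var 0) (.var 4))]
      (store 2 (.var 0) (.var 0) (.num 1))) (s := s₁)
    (fun k s' => s'.reg 4 = x ∧ s'.tab 1 = s₁.tab 1 ∧
      pairs n s' = {c | c.1 = c.2 ∧ (c.1 : ℕ) < k ∧ c.1 ∈ marked n 1 s₁ \ {x}})
    ⟨hx₁, rfl, by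
      ext c
      simp [pairs, hclear]⟩
    (by
      rintro k s' ⟨h1, h2, h3⟩
      refine ⟨by rw [run_reg (by decide)]; simpa using h1, by rw [run_tab (by decide)]; exact h2, ?_⟩
      rw [pairs_guarded_store (u := k) (w := k) _ _ _ _ (by simp [Expr.eval]) (by simp [Expr.eval])]
      have : pairs n (s'.setReg 0 k) = pairs n s' := rfl
      rw [this, h3]
      ext ⟨i, j⟩
      simp only [Set.mem_union, Set.mem_ofPred_eq, Prod.mk.injEq, Nat.lt_succ_iff_lt_or_eq,
        ← Fin.ext_iff]
      have : (∀ e ∈ [Expr.cell 1 (.var 0) (.num 0), .not (.eq (.var 0) (.var 4))],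
          e.eval G (s'.setReg 0 k) ≠ 0) ↔ k ∈ marked n 1 s₁ \ {x} := by
        simp [Expr.eval, h1, h2, marked, Fin.ext_iff]
      rw [this]
      constructor
      · rintro (⟨a, b, c⟩ | ⟨a, rfl, rfl⟩)
        · exact ⟨a, .inl b, c⟩
        · exact ⟨rfl, .inr rfl, a⟩
      · rintro ⟨a, b | rfl, c⟩
        · exact .inl ⟨a, b, c⟩
        · exact .inr ⟨c, rfl, a.symm⟩)
    (by
      rintro s' ⟨h1, h2, h3⟩
      exact ⟨by simpa using h1, h2, h3⟩)
  replace hinit := hinit.2.2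
  generalize run G H (loop 0 (guarded [.cell 1 (.var 0) (.num 0), .not (.eq (.var 0) (.var 4))]
      (store 2 (.var 0) (.var 0) (.num 1)))) s₁ = s₂ at *
  have happ := approx_hullRounds (G := G) (H := H) s₂
  generalize run G H (loop 5 (loop 6 (loop 0 (loop 1 (loop 2 hullLeaf))))) s₂ = s₃ at *
  have hdiag : {v | (v, v) ∈ pairs n s₃} = mHull G (marked n 1 s₁ \ {x}) := by
    refine diag_eq_mHull (happ.closed (by simp)) (fun v hv => happ.1 ?_) fun C hC hv =>
      happ.2.1 C hC ?_
    · rw [hinit]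
      exact ⟨rfl, v.2, hv⟩
    · rw [hinit]
      rintro ⟨i, j⟩ ⟨h, -, h'⟩
      obtain rfl : i = j := h
      exact hv i h'
  rw [← hdiag]
  have hfinal := loop_induct (G := G) (H := H) (x := 0)
    (b := guarded [.not (.cell 2 (.var 0) (.var 0))] (assign 7 (.num 0)))
    (s := run G H (assign 7 (.num 1)) s₃)
    (fun k s' => s'.tab 2 = s₃.tab 2 ∧
      s'.reg 7 = if ∀ v : Fin n, (v : ℕ) < k → (v, v) ∈ pairs n s₃ then 1 else 0)
    ⟨rfl, by simp [run, Expr.eval]⟩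
    (by
      rintro k s' ⟨h1, h2⟩
      refine ⟨by rw [run_tab (by decide)]; exact h1, ?_⟩
      rw [run_guarded]
      have hk : (∀ v : Fin n, (v : ℕ) < k + 1 → (v, v) ∈ pairs n s₃) ↔
          (∀ v : Fin n, (v : ℕ) < k → (v, v) ∈ pairs n s₃) ∧ (k, k) ∈ pairs n s₃ := by
        refine ⟨fun h => ⟨fun v hv => h v (by omega), h k (by omega)⟩, fun h v hv => ?_⟩
        rcases Nat.lt_succ_iff_lt_or_eq.1 hv with hv | hv
        · exact h.1 v hv
        · rw [Fin.ext hv]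
          exact h.2
      have hg : (∀ e ∈ [Expr.not (.cell 2 (.var 0) (.var 0))],
          e.eval G (s'.setReg 0 k) ≠ 0) ↔ (k, k) ∉ pairs n s₃ := by
        simp [Expr.eval, h1, pairs]
      simp only [hg, hk]
      by_cases hkk : (k, k) ∈ pairs n s₃
      · simp [hkk, h2]
      · simp [hkk, run, Expr.eval])
    (by
      rintro s' ⟨h1, h2⟩
      exact ⟨h1, by simpa using h2⟩)
  rw [hfinal.2]
  refine if_congr ?_ rfl rfl
  simp [Set.eq_univ_iff_forall]

/-- Write a minimal hull set to table `1`. -/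
def minimalProg : Prog :=
  seq (loop 0 (store 1 (.var 0) (.num 0) (.num 1)))
    (loop 4 (seq hullProg (ite (.var 7) (store 1 (.var 4) (.num 0) (.num 0)) skip)))

/-- Greedy deletion gives minimality in one pass: a vertex that was indispensable stays so as the
set shrinks, by monotonicity of the hull. -/
theorem run_minimalProg (s : State) :
    mHull G (marked n 1 (minimalProg.run G H s)) = Set.univ ∧
      ∀ v ∈ marked n 1 (minimalProg.run G H s),
        mHull G (marked n 1 (minimalProg.run G H s) \ {v}) ≠ Set.univ := by
  classical
  rw [minimalProg, run_seq]
  have hinit := loop_induct (G := G) (H := H) (x := 0)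
    (b := store 1 (.var 0) (.num 0) (.num 1)) (s := s)
    (fun k s' => ∀ v : Fin n, (v : ℕ) < k → v ∈ marked n 1 s') (by simp)
    (by
      intro k s' h v hv
      by_cases hvk : (v : ℕ) = k
      · simp [marked, run, Expr.eval, hvk]
      · have : s'.tab 1 v 0 ≠ 0 := h v (by omega)
        simp [marked, run, Expr.eval, hvk, this])
    (fun _ h => h)
  generalize run G H (loop 0 (store 1 (.var 0) (.num 0) (.num 1))) s = s₁ at *
  have := loop_induct (G := G) (H := H) (x := 4)
    (b := seq hullProg (ite (.var 7) (store 1 (.var 4) (.num 0) (.num 0)) skip)) (s := s₁)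
    (fun k s' => mHull G (marked n 1 s') = Set.univ ∧
      ∀ v ∈ marked n 1 s', (v : ℕ) < k → mHull G (marked n 1 s' \ {v}) ≠ Set.univ)
    ⟨Set.eq_univ_of_forall fun v => subset_mHull _ (hinit v v.2), by simp⟩
    (by
      rintro k s' ⟨h1, h2⟩
      rw [run_seq]
      have h4 : (hullProg.run G H (s'.setReg 4 k)).reg 4 = k := by
        rw [run_reg (by decide)]; simp
      have h7 := run_hullProg (G := G) (H := H) (s := s'.setReg 4 k) (x := k) (by simp)
      have hm : marked n 1 (s'.setReg 4 k) = marked n 1 s' := rfl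
      have hm' : marked n 1 (hullProg.run G H (s'.setReg 4 k)) = marked n 1 s' := by
        simp only [marked, run_tab (c := hullProg) (a := 1) (by decide)]
        rfl
      rw [hm] at h7
      generalize hullProg.run G H (s'.setReg 4 k) = s₂ at *
      by_cases hk : mHull G (marked n 1 s' \ {k}) = Set.univ
      · rw [if_pos hk] at h7
        have hm₃ : marked n 1 ((ite (.var 7) (store 1 (.var 4) (.num 0) (.num 0)) skip).run G H s₂)
            = marked n 1 s' \ {k} := by
          rw [← hm']
          ext v
          by_cases hvk : v = k
          · simp [marked, run, Expr.eval, h7, h4, hvk]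
          · have : ¬ (v : ℕ) = k := fun h => hvk (Fin.ext h)
            simp [marked, run, Expr.eval, h7, h4, hvk, this]
        rw [hm₃]
        refine ⟨hk, fun v hv hvk => ?_⟩
        intro hcon
        have hne : (v : ℕ) ≠ k := fun h => hv.2 (Fin.ext h)
        refine h2 v hv.1 (by omega) (Set.eq_univ_of_univ_subset ?_)
        rw [← hcon]
        refine mHull_subset (isMConvex_mHull _) (Set.Subset.trans ?_ (subset_mHull _))
        exact Set.sdiff_subset_sdiff_left Set.sdiff_subset
      · rw [if_neg hk] at h7
        have : (ite (.var 7) (store 1 (.var 4) (.num 0) (.num 0)) skip).run G H s₂ = s₂ := by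
          simp [run, Expr.eval, h7]
        rw [this, hm']
        refine ⟨h1, fun v hv hvk => ?_⟩
        rcases Nat.lt_succ_iff_lt_or_eq.1 hvk with hvk | hvk
        · exact h2 v hv hvk
        · rw [Fin.ext hvk]
          exact hk)
    (fun _ h => h)
  exact ⟨this.1, fun v hv => this.2 v hv v.2⟩

/-! ### Querying the hull set -/

/-- Query one vertex and record it as a positive or negative example. -/
def queryBody : Prog :=
  seq (query 8 (.var 0)) (ite (.var 8) (seq (assign 9 (.var 0)) (assign 10 (.num 1)))
    (seq (assign 11 (.var 0)) (assign 12 (.num 1))))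

/-- Query the vertices marked in table `1`.  A positive vertex is written to register `9` and a
negative one to register `11`; registers `10` and `12` tell whether these exist. -/
def queryProg : Prog := loop 0 (ite (.cell 1 (.var 0) (.num 0)) queryBody skip)

/-- Registers `10` and `9` hold a positive example if there is one in `S`, and registers `12` and
`11` a negative one. -/
def Examples (H S : Set (Fin n)) (s : State) : Prop :=
  (s.reg 10 = 0 → ∀ v ∈ S, v ∉ H) ∧ (s.reg 10 ≠ 0 → ∃ a : Fin n, s.reg 9 = a ∧ a ∈ H) ∧
    (s.reg 12 = 0 → ∀ v ∈ S, v ∈ H) ∧ (s.reg 12 ≠ 0 → ∃ b : Fin n, s.reg 11 = b ∧ b ∉ H)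

theorem run_queryBody {S : Set (Fin n)} {k : Fin n} {s : State} (h0 : s.reg 0 = k)
    (hs : Examples H S s) : Examples H (insert k S) (queryBody.run G H s) := by
  classical
  obtain ⟨h1, h2, h3, h4⟩ := hs
  by_cases hk : k ∈ H
  · refine ⟨?_, ?_, ?_, ?_⟩ <;> simp [queryBody, run, Expr.eval, h0, hk]
    · exact ⟨k, rfl, hk⟩
    · exact h3
    · exact h4
  · refine ⟨?_, ?_, ?_, ?_⟩ <;> simp [queryBody, run, Expr.eval, h0, hk]
    · exact h1
    · exact h2
    · exact ⟨k, rfl, hk⟩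

open Classical in
theorem run_queryProg {s : State} (h10 : s.reg 10 = 0) (h12 : s.reg 12 = 0) :
    Examples H (marked n 1 s) (queryProg.run G H s) ∧
      queryProg.queries G H s = (Finset.univ.filter (· ∈ marked n 1 s)).card := by
  have := loop_induct_queries (G := G) (H := H) (x := 0)
    (b := ite (.cell 1 (.var 0) (.num 0)) queryBody skip) (s := s)
    (fun k s' q => s'.tab 1 = s.tab 1 ∧ Examples H {v | v ∈ marked n 1 s ∧ (v : ℕ) < k} s' ∧
      q = (Finset.univ.filter fun v : Fin n => v ∈ marked n 1 s ∧ (v : ℕ) < k).card)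
    ⟨rfl, by simp [Examples, h10, h12], by simp⟩
    (by
      rintro k s' q ⟨h1, h2, h3⟩
      refine ⟨by rw [run_tab (by decide)]; exact h1, ?_⟩
      have hE : Examples H {v | v ∈ marked n 1 s ∧ (v : ℕ) < k} (s'.setReg 0 k) := by
        simpa [Examples] using h2
      have hev : Expr.eval G (s'.setReg 0 k) (.cell 1 (.var 0) (.num 0)) = s.tab 1 k 0 := by
        simp [Expr.eval, h1]
      by_cases hk : k ∈ marked n 1 s
      · have hS : {v | v ∈ marked n 1 s ∧ (v : ℕ) < k + 1} =
            insert k {v | v ∈ marked n 1 s ∧ (v : ℕ) < k} := by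
          ext v
          simp only [Set.mem_ofPred_eq, Set.mem_insert_iff, Fin.ext_iff]
          constructor
          · rintro ⟨a, b⟩
            by_cases hvk : (v : ℕ) = k
            · exact .inl hvk
            · exact .inr ⟨a, by omega⟩
          · rintro (h | ⟨a, b⟩)
            · exact ⟨by rwa [Fin.ext h], by omega⟩
            · exact ⟨a, by omega⟩
        have hF : (Finset.univ.filter fun v : Fin n => v ∈ marked n 1 s ∧ (v : ℕ) < k + 1) =
            insert k (Finset.univ.filter fun v : Fin n => v ∈ marked n 1 s ∧ (v : ℕ) < k) := by
          ext v
          have := Set.ext_iff.1 hS v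
          simpa using this
        have hne : s.tab 1 k 0 ≠ 0 := hk
        rw [hS, hF, Finset.card_insert_of_notMem (by simp), ← h3]
        simp only [run, queries, hev, hne, if_false]
        exact ⟨run_queryBody (by simp) hE, by simp [queryBody, queries]⟩
      · have hiff : ∀ v : Fin n, (v ∈ marked n 1 s ∧ (v : ℕ) < k + 1) ↔
            (v ∈ marked n 1 s ∧ (v : ℕ) < k) := by
          refine fun v => ⟨fun ⟨a, b⟩ => ⟨a, ?_⟩, fun ⟨a, b⟩ => ⟨a, by omega⟩⟩
          by_contra hcon
          exact hk (by rwa [← (Fin.ext (by omega) : v = k)])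
        have hz : s.tab 1 k 0 = 0 := by
          by_contra h
          exact hk h
        simp only [hiff, run, queries, hev, hz, if_true]
        exact ⟨hE, by omega⟩)
    (by
      rintro s' q ⟨h1, h2, h3⟩
      exact ⟨h1, by simpa [Examples] using h2, h3⟩)
  simpa [queryProg] using this.2

/-! ### Binary search for a cut edge -/

/-- Write a middle vertex between the vertices in registers `9` and `11` to register `13`. -/
def midProg : Prog :=
  loop 1 (guarded [.eq (.cell 3 (.var 9) (.var 1))
      (.add (.half (.sub (.cell 3 (.var 9) (.var 11)) (.num 1))) (.num 1)),
    .eq (.add (.cell 3 (.var 9) (.var 1)) (.cell 3 (.var 1) (.var 11)))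
      (.add (.cell 3 (.var 9) (.var 11)) (.num 1))] (assign 13 (.var 1)))

/-- One round of binary search. -/
def searchBody : Prog :=
  seq midProg (seq (query 8 (.var 13)) (ite (.var 8) (assign 9 (.var 13)) (assign 11 (.var 13))))

/-- Binary search for an edge between a positive and a negative vertex. -/
def searchProg : Prog :=
  loop 0 (ite (.lt (.num 2) (.cell 3 (.var 9) (.var 11))) searchBody skip)

/-- Table `3` holds the distances plus one. -/
def DistTable (G : SimpleGraph (Fin n)) (s : State) : Prop :=
  ∀ i j : Fin n, s.tab 3 i j = G.dist i j + 1

theorem run_midProg (hG : G.Connected) {s : State} (hs : DistTable G s) {a b : Fin n}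
    (h9 : s.reg 9 = a) (h11 : s.reg 11 = b) :
    ∃ m : Fin n, (midProg.run G H s).reg 13 = m ∧ G.dist a m = G.dist a b / 2 ∧
      G.dist a m + G.dist m b = G.dist a b := by
  classical
  have := loop_induct (G := G) (H := H) (x := 1)
    (b := guarded [.eq (.cell 3 (.var 9) (.var 1))
      (.add (.half (.sub (.cell 3 (.var 9) (.var 11)) (.num 1))) (.num 1)),
    .eq (.add (.cell 3 (.var 9) (.var 1)) (.cell 3 (.var 1) (.var 11)))
      (.add (.cell 3 (.var 9) (.var 11)) (.num 1))] (assign 13 (.var 1))) (s := s)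
    (fun k s' => s'.tab 3 = s.tab 3 ∧ s'.reg 9 = a ∧ s'.reg 11 = b ∧
      ((∃ m : Fin n, (m : ℕ) < k ∧ G.dist a m = G.dist a b / 2 ∧
        G.dist a m + G.dist m b = G.dist a b) →
      ∃ m : Fin n, s'.reg 13 = m ∧ G.dist a m = G.dist a b / 2 ∧
        G.dist a m + G.dist m b = G.dist a b))
    ⟨rfl, h9, h11, by simp⟩
    (by
      rintro k s' ⟨ht, ha, hb, ih⟩
      refine ⟨by rw [run_tab (by decide)]; exact ht, by rw [run_reg (by decide)]; simpa using ha,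
        by rw [run_reg (by decide)]; simpa using hb, ?_⟩
      rintro ⟨m, hm, hm'⟩
      rw [run_guarded]
      split_ifs with h
      · simp [Expr.eval, ha, hb, ht, hs a k, hs a b, hs k b] at h
        exact ⟨k, by simp [run, Expr.eval], h.1, by omega⟩
      · have hmk : m ≠ k := by
          rintro rfl
          apply h
          simp [Expr.eval, ha, hb, ht, hs a m, hs a b, hs m b]
          exact ⟨hm'.1, by omega⟩
        have : (m : ℕ) ≠ k := fun h => hmk (Fin.ext h)
        simpa using ih ⟨m, by omega, hm'⟩)
    (by
      rintro s' ⟨h1, h2, h3, h4⟩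
      exact ⟨h1, by simpa using h2, by simpa using h3, by simpa using h4⟩)
  obtain ⟨m, h1, h2⟩ := exists_dist_eq hG a b (k := G.dist a b / 2) (Nat.div_le_self _ _)
  exact this.2.2.2 ⟨m, m.2, h1, h2⟩

theorem run_searchProg (hG : G.Connected) {s : State} (hs : DistTable G s) {a b : Fin n}
    (h9 : s.reg 9 = a) (h11 : s.reg 11 = b) (ha : a ∈ H) (hb : b ∉ H) :
    ∃ a' b' : Fin n, (searchProg.run G H s).reg 9 = a' ∧ (searchProg.run G H s).reg 11 = b' ∧
      a' ∈ H ∧ b' ∉ H ∧ G.Adj a' b' ∧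
      searchProg.queries G H s ≤ Nat.clog 2 (G.dist a b) := by
  classical
  have := loop_induct_queries (G := G) (H := H) (x := 0)
    (b := ite (.lt (.num 2) (.cell 3 (.var 9) (.var 11))) searchBody skip) (s := s)
    -- The distance drops by at least one per round until it is 1, so `n` rounds are enough.
    -- Independently, `Nat.clog` of the distance drops by at least one per query, which bounds the
    -- queries.
    (fun k s' q => DistTable G s' ∧ ∃ a' b' : Fin n, s'.reg 9 = a' ∧ s'.reg 11 = b' ∧
      a' ∈ H ∧ b' ∉ H ∧ (G.dist a' b' = 1 ∨ G.dist a' b' + k ≤ G.dist a b) ∧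
      q + Nat.clog 2 (G.dist a' b') ≤ Nat.clog 2 (G.dist a b))
    ⟨hs, a, b, h9, h11, ha, hb, by simp, by simp⟩
    (by
      rintro k s' q ⟨ht, a', b', h9, h11, ha, hb, hd, hq⟩
      have hpos : 0 < G.dist a' b' := hG.pos_dist_of_ne (by rintro rfl; exact hb ha)
      have hev : Expr.eval G (s'.setReg 0 k) (.lt (.num 2) (.cell 3 (.var 9) (.var 11))) =
          if 1 < G.dist a' b' then 1 else 0 := by
        simp [Expr.eval, h9, h11, ht a' b', Nat.succ_le_iff]
      by_cases h1 : 1 < G.dist a' b'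
      · simp only [run, queries, hev, h1, if_true, one_ne_zero, if_false]
        obtain ⟨m, hm, hm1, hm2⟩ := run_midProg (H := H) hG (s := s'.setReg 0 k) ht
          (a := a') (b := b') (by simpa using h9) (by simpa using h11)
        have hq1 : searchBody.queries G H (s'.setReg 0 k) = 1 := by
          simp only [searchBody, queries, queries_of_silent (c := midProg) (by decide)]
          simp
        have ht' : DistTable G (searchBody.run G H (s'.setReg 0 k)) := by
          intro i j
          rw [run_tab (by decide)]
          exact ht i j
        have h9' : (midProg.run G H (s'.setReg 0 k)).reg 9 = a' := by
          rw [run_reg (by decide)]; simpa using h9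
        have h11' : (midProg.run G H (s'.setReg 0 k)).reg 11 = b' := by
          rw [run_reg (by decide)]; simpa using h11
        rw [hq1]
        refine ⟨ht', ?_⟩
        -- The two parts have lengths `d / 2` and `d - d / 2`, both at most `(d + 1) / 2`.
        have hclog := Nat.clog_of_two_le (b := 2) (n := G.dist a' b') (by norm_num) h1
        by_cases hmH : m ∈ H
        · refine ⟨m, b', ?_, ?_, hmH, hb, by omega, ?_⟩
          · simp [searchBody, run, Expr.eval, hm, hmH]
          · simp [searchBody, run, Expr.eval, hm, hmH, h11']
          · have := Nat.clog_mono_right 2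
              (by omega : G.dist m b' ≤ (G.dist a' b' + 2 - 1) / 2)
            omega
        · refine ⟨a', m, ?_, ?_, ha, hmH, by omega, ?_⟩
          · simp [searchBody, run, Expr.eval, hm, hmH, h9']
          · simp [searchBody, run, Expr.eval, hm, hmH]
          · have := Nat.clog_mono_right 2
              (by omega : G.dist a' m ≤ (G.dist a' b' + 2 - 1) / 2)
            omega
      · simp only [run, queries, hev, h1, if_false, if_true]
        exact ⟨ht, a', b', by simpa using h9, by simpa using h11, ha, hb, by omega, by simpa using hq⟩)
    (by
      rintro s' q ⟨ht, a', b', h9, h11, h⟩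
      exact ⟨ht, a', b', by simpa using h9, by simpa using h11, h⟩)
  obtain ⟨-, a', b', h9, h11, ha, hb, hd, hq⟩ := this
  have := dist_lt_card hG a b
  exact ⟨a', b', h9, h11, ha, hb, SimpleGraph.dist_eq_one_iff_adj.1 (by omega),
    le_of_add_le_left hq⟩

/-! ### Labels near the cut edge -/

/-- Determine the label of one vertex adjacent to the cut edge. -/
def labelBody : Prog :=
  ite (.adj (.var 9) (.var 0))
    (ite (.adj (.var 11) (.var 0))
      (seq (query 8 (.var 0)) (store 4 (.var 0) (.num 0) (.add (.var 8) (.num 1))))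
      (store 4 (.var 0) (.num 0) (.num 2)))
    (ite (.adj (.var 11) (.var 0)) (store 4 (.var 0) (.num 0) (.num 1)) skip)

/-- Write the labels plus one of the neighbours of the cut edge to table `4`. -/
def labelProg : Prog :=
  seq (loop 0 labelBody) (seq (store 4 (.var 9) (.num 0) (.num 2))
    (store 4 (.var 11) (.num 0) (.num 1)))

open Classical in
/-- The label plus one for vertices equal or adjacent to `a` or `b`, and `0` for the others. -/
noncomputable def nearLabel (G : SimpleGraph (Fin n)) (H : Set (Fin n)) (a b v : Fin n) : ℕ :=
  if v = a ∨ v = b ∨ G.Adj a v ∨ G.Adj b v then (if v ∈ H then 2 else 1) else 0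

-- A neighbour `v ≠ b` of `a` outside `H` would make `av` a cut edge, so `v` would be adjacent to
-- `b`; symmetrically for neighbours of `b`. Only common neighbours need a query.
open Classical in
theorem run_labelProg (hG : G.Connected) (hH : IsMConvex G H) (hH' : IsMConvex G Hᶜ)
    {s : State} (hs : ∀ i j, s.tab 4 i j = 0) {a b : Fin n} (h9 : s.reg 9 = a)
    (h11 : s.reg 11 = b) (ha : a ∈ H) (hb : b ∉ H) (hab : G.Adj a b) :
    (∀ v : Fin n, (labelProg.run G H s).tab 4 v 0 = nearLabel G H a b v) ∧
      labelProg.queries G H s = (Finset.univ.filter fun v => G.Adj a v ∧ G.Adj b v).card := by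
  have := loop_induct_queries (G := G) (H := H) (x := 0) (b := labelBody) (s := s)
    -- The vertices `a` and `b` are excluded because the loop labels them wrongly: each is adjacent
    -- to the other but not to itself. The two final stores repair this.
    (fun k s' q => s'.reg 9 = a ∧ s'.reg 11 = b ∧ (∀ v : Fin n, v ≠ a → v ≠ b →
      s'.tab 4 v 0 = if (v : ℕ) < k then nearLabel G H a b v else 0) ∧
      q = (Finset.univ.filter fun v : Fin n => (G.Adj a v ∧ G.Adj b v) ∧ (v : ℕ) < k).card)
    ⟨h9, h11, by simp [hs], by simp⟩
    (by
      rintro k s' q ⟨h9, h11, h1, h2⟩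
      refine ⟨by rw [run_reg (by decide)]; simpa using h9,
        by rw [run_reg (by decide)]; simpa using h11, fun v hva hvb => ?_, ?_⟩
      · have h1v := h1 v hva hvb
        by_cases hvk : v = k
        · subst hvk
          rw [if_neg (lt_irrefl _)] at h1v
          rw [if_pos (by omega)]
          by_cases hav : G.Adj a v <;> by_cases hbv : G.Adj b v
          · by_cases hv : v ∈ H <;>
            simp [labelBody, run, Expr.eval, h9, h11, hav, hbv, nearLabel, hv]
          · have hv : v ∈ H := by
              by_contra hv
              exact hbv (adj_of_cut' hG hH hH' ha ha hb hv hab hav (Ne.symm hvb))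
            simp [labelBody, run, Expr.eval, h9, h11, hav, hbv, nearLabel, hv]
          · have hv : v ∉ H := fun hv =>
              hav (adj_of_cut hG hH hH' ha hv hb hb hab hbv.symm (Ne.symm hva))
            simp [labelBody, run, Expr.eval, h9, h11, hav, hbv, nearLabel, hv]
          · simp [labelBody, run, Expr.eval, h9, h11, hav, hbv, nearLabel, hva, hvb, h1v]
        · have hvk' : ¬ (v : ℕ) = k := fun h => hvk (Fin.ext h)
          have : (labelBody.run G H (s'.setReg 0 k)).tab 4 v 0 = s'.tab 4 v 0 := by
            simp only [labelBody, run]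
            split_ifs <;> simp [Expr.eval, hvk']
          rw [this, h1v]
          refine if_congr ?_ rfl rfl
          omega
      · by_cases hk : G.Adj a k ∧ G.Adj b k
        · have hF : (Finset.univ.filter fun v : Fin n => (G.Adj a v ∧ G.Adj b v) ∧
              (v : ℕ) < k + 1) = insert k (Finset.univ.filter fun v : Fin n =>
                (G.Adj a v ∧ G.Adj b v) ∧ (v : ℕ) < k) := by
            ext v
            simp only [Finset.mem_filter, Finset.mem_univ, true_and, Finset.mem_insert]
            constructor
            · rintro ⟨h, h'⟩
              by_cases hvk : v = k
              · exact .inl hvk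
              · have : (v : ℕ) ≠ k := fun h => hvk (Fin.ext h)
                exact .inr ⟨h, by omega⟩
            · rintro (rfl | ⟨h, h'⟩)
              · exact ⟨hk, by omega⟩
              · exact ⟨h, by omega⟩
          rw [hF, Finset.card_insert_of_notMem (by simp), ← h2]
          simp [labelBody, queries, Expr.eval, h9, h11, hk]
        · have hF : (Finset.univ.filter fun v : Fin n => (G.Adj a v ∧ G.Adj b v) ∧
              (v : ℕ) < k + 1) = (Finset.univ.filter fun v : Fin n =>
                (G.Adj a v ∧ G.Adj b v) ∧ (v : ℕ) < k) := by
            ext v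
            simp only [Finset.mem_filter, Finset.mem_univ, true_and]
            refine and_congr_right fun h => ?_
            have : (v : ℕ) ≠ k := fun h' => hk (by rwa [← Fin.ext h'])
            omega
          rw [hF, ← h2]
          by_cases hak : G.Adj a k
          · have hbk : ¬ G.Adj b k := fun h => hk ⟨hak, h⟩
            simp [labelBody, queries, Expr.eval, h9, h11, hak, hbk]
          · simp [labelBody, queries, Expr.eval, h9, h11, hak])
    (by
      rintro s' q ⟨h9, h11, h⟩
      exact ⟨by simpa using h9, by simpa using h11, h⟩)
  obtain ⟨k9, k11, h1, h2⟩ := this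
  constructor
  · intro v
    rw [labelProg, run_seq, run_seq]
    generalize run G H (loop 0 labelBody) s = s₁ at *
    by_cases hvb : v = b
    · subst hvb
      simp [run, Expr.eval, k11, nearLabel, hb]
    · have hvb' : ¬ (v : ℕ) = b := fun h => hvb (Fin.ext h)
      by_cases hva : v = a
      · subst hva
        simp [run, Expr.eval, k11, k9, nearLabel, ha, hvb']
      · have hva' : ¬ (v : ℕ) = a := fun h => hva (Fin.ext h)
        have := h1 v hva hvb
        rw [if_pos v.2] at this
        rw [← this]
        simp [run, Expr.eval, k11, k9, hva', hvb']
  · simp only [labelProg, queries] at h2 ⊢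
    rw [h2]
    simp

/-! ### Spreading the positive label -/

/-- Pass membership in the output on along an edge. -/
def spreadLeaf : Prog :=
  guarded [.cell 0 (.var 0) (.num 0), .adj (.var 0) (.var 1),
    .not (.eq (.add (.cell 4 (.var 0) (.num 0)) (.cell 4 (.var 1) (.num 0))) (.num 3))]
    (store 0 (.var 1) (.num 0) (.num 1))

/-- Output the component of the vertex in register `9` after deletion of all edges between
vertices with different labels in table `4`. -/
def spreadProg : Prog :=
  seq (store 0 (.var 9) (.num 0) (.num 1)) (loop 3 (loop 0 (loop 1 spreadLeaf)))

/-- The vertices reached from `X` by an edge that is not known to be cut. -/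
def spreadStep (G : SimpleGraph (Fin n)) (L : Fin n → ℕ) (X : Set (Fin n)) : Set (Fin n) :=
  {y | ∃ x ∈ X, G.Adj x y ∧ L x + L y ≠ 3}

theorem run_spreadLeaf {L : Fin n → ℕ} {s : State} (hL : ∀ v : Fin n, s.tab 4 v 0 = L v)
    {x y : Fin n} (h0 : s.reg 0 = x) (h1 : s.reg 1 = y) :
    marked n 0 (spreadLeaf.run G H s) =
      marked n 0 s ∪ {c | (x ∈ marked n 0 s ∧ G.Adj x y ∧ L x + L y ≠ 3) ∧ c = y} := by
  classical
  have hg : (∀ e ∈ [Expr.cell 0 (.var 0) (.num 0), .adj (.var 0) (.var 1),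
      .not (.eq (.add (.cell 4 (.var 0) (.num 0)) (.cell 4 (.var 1) (.num 0))) (.num 3))],
      e.eval G s ≠ 0) ↔ (x ∈ marked n 0 s ∧ G.Adj x y ∧ L x + L y ≠ 3) := by
    simp [Expr.eval, h0, h1, hL, marked]
  rw [spreadLeaf, run_guarded]
  simp only [hg]
  ext v
  split_ifs with h
  · by_cases hv : v = y
    · subst hv
      exact iff_of_true (by simp [marked, run, Expr.eval, h1]) (.inr ⟨h, rfl⟩)
    · have hv' : ¬ (v : ℕ) = y := fun h => hv (Fin.ext h)
      simp [marked, run, Expr.eval, h1, hv, hv']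
  · simp [h]

theorem approx_spreadRound {L : Fin n → ℕ} {X₀ : Set (Fin n)} {k : ℕ} {s : State}
    (hL : ∀ v : Fin n, s.tab 4 v 0 = L v) (h : Approx (spreadStep G L) X₀ k (marked n 0 s)) :
    Approx (spreadStep G L) X₀ (k + 1)
      (marked n 0 ((loop 0 (loop 1 spreadLeaf)).run G H s)) := by
  obtain ⟨h1, h2⟩ := loop_all₂ (G := G) (H := H) (x := 0) (y := 1) (b := spreadLeaf) (s := s)
    (by decide) (by decide)
    (fun s s' => s'.tab 4 = s.tab 4 ∧ marked n 0 s ⊆ marked n 0 s' ∧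
      ((∀ v : Fin n, s.tab 4 v 0 = L v) →
        ∀ C, spreadStep G L C ⊆ C → marked n 0 s ⊆ C → marked n 0 s' ⊆ C))
    (fun s => ⟨rfl, subset_rfl, fun _ _ _ h => h⟩)
    (fun s₁ s₂ s₃ h h' => ⟨h'.1.trans h.1, h.2.1.trans h'.2.1,
      fun hL C hC hX => h'.2.2 (by rwa [h.1]) C hC (h.2.2 hL C hC hX)⟩)
    (fun s u k _ => ⟨rfl, subset_rfl, fun _ _ _ h => h⟩)
    (fun x y s' => x ∈ marked n 0 s → G.Adj x y → L x + L y ≠ 3 → y ∈ marked n 0 s')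
    (fun x y s s' h h' a b c => h.2.1 (h' a b c))
    (fun x y s' hR h0 h1 => by
      have hleaf := run_spreadLeaf (G := G) (H := H) (by rwa [hR.1] : ∀ v : Fin n, _ = L v) h0 h1
      refine ⟨⟨run_tab (by decide) _, by rw [hleaf]; exact Set.subset_union_left, ?_⟩, ?_⟩
      · intro _ C hC hX
        rw [hleaf]
        refine Set.union_subset hX ?_
        rintro _ ⟨⟨a, b, c⟩, rfl⟩
        exact hC ⟨x, hX a, b, c⟩
      · intro a b c
        rw [hleaf]
        exact .inr ⟨⟨hR.2.1 a, b, c⟩, rfl⟩)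
  refine h.succ h1.2.1 ?_ (h1.2.2 hL)
  rintro y ⟨x, hx, hxy, hl⟩
  exact h2 x y hx hxy hl

/-- The stored values are 2 in `H`, 1 outside and 0 if unknown, so a sum of 3 means opposite known
labels. Every cut edge has this sum because both its ends are near `ab`. Hence spreading never
leaves `H`, and it fills `H` because `H` is connected. -/
theorem run_spreadProg (hG : G.Connected) (hH : IsMConvex G H) (hH' : IsMConvex G Hᶜ)
    {s : State} {a b : Fin n} (hL : ∀ v : Fin n, s.tab 4 v 0 = nearLabel G H a b v)
    (hs : ∀ i j, s.tab 0 i j = 0) (h9 : s.reg 9 = a) (ha : a ∈ H) (hb : b ∉ H)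
    (hab : G.Adj a b) : marked n 0 (spreadProg.run G H s) = H := by
  classical
  rw [spreadProg, run_seq]
  have hinit : marked n 0 ((store 0 (.var 9) (.num 0) (.num 1)).run G H s) = {a} := by
    ext v
    by_cases hv : v = a
    · simp [marked, run, Expr.eval, h9, hv]
    · have hv' : ¬ (v : ℕ) = a := fun h => hv (Fin.ext h)
      simp [marked, run, Expr.eval, h9, hv, hv', hs]
  have hL' : ∀ v : Fin n, ((store 0 (.var 9) (.num 0) (.num 1)).run G H s).tab 4 v 0 =
      nearLabel G H a b v := by
    intro v
    rw [run_tab (by decide), hL]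
  generalize (store 0 (.var 9) (.num 0) (.num 1)).run G H s = s₁ at *
  have happ := loop_induct (G := G) (H := H) (x := 3) (b := loop 0 (loop 1 spreadLeaf)) (s := s₁)
    (fun k s' => (∀ v : Fin n, s'.tab 4 v 0 = nearLabel G H a b v) ∧
      Approx (spreadStep G (nearLabel G H a b)) {a} k (marked n 0 s'))
    ⟨hL', by rw [hinit]; exact .zero _ _⟩
    (by
      rintro k s' ⟨h1, h2⟩
      refine ⟨?_, approx_spreadRound (s := s'.setReg 3 k) h1 h2⟩
      intro v
      rw [run_tab (by decide)]
      exact h1 v)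
    (fun _ h => h)
  replace happ := happ.2
  have hcl := happ.closed (by simp)
  apply Set.Subset.antisymm
  · refine happ.2.1 H ?_ (Set.singleton_subset_iff.2 ha)
    rintro y ⟨x, hx, hxy, hl⟩
    by_contra hy
    apply hl
    have hx' : x = a ∨ x = b ∨ G.Adj a x ∨ G.Adj b x := by
      by_cases hxa : x = a
      · exact .inl hxa
      · exact .inr (.inr (.inl (adj_of_cut hG hH hH' ha hx hb hy hab hxy (Ne.symm hxa))))
    have hy' : y = a ∨ y = b ∨ G.Adj a y ∨ G.Adj b y := by
      by_cases hyb : y = b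
      · exact .inr (.inl hyb)
      · exact .inr (.inr (.inr (adj_of_cut' hG hH hH' ha hx hb hy hab hxy (Ne.symm hyb))))
    rw [nearLabel, nearLabel, if_pos hx', if_pos hy', if_pos hx, if_neg hy]
  · intro v hv
    have hj := hH.joins hG ha hv
    have key : v ∈ marked n 0 (run G H (loop 3 (loop 0 (loop 1 spreadLeaf))) s₁) ∧ v ∈ H := by
      induction hj with
      | refl => exact ⟨happ.1 rfl, ha⟩
      | @tail x y _ hxy ih =>
        have ih := ih (by
          rename_i h
          exact Joins.mem h ha)
        refine ⟨hcl ⟨x, ih.1, hxy.1, ?_⟩, hxy.2⟩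
        have hyH : y ∈ H := hxy.2
        simp only [nearLabel, ih.2, hyH, if_true]
        split_ifs <;> omega
    exact key.1

/-! ### The learning algorithm -/

/-- The learning algorithm. -/
def learner : Prog :=
  seq distProg (seq minimalProg (seq queryProg
    (ite (.var 10)
      (ite (.var 12) (seq searchProg (seq labelProg spreadProg))
        (loop 0 (store 0 (.var 0) (.num 0) (.num 1))))
      skip)))

theorem marked_fill (s : State) :
    marked n 0 ((loop 0 (store 0 (.var 0) (.num 0) (.num 1))).run G H s) = Set.univ := by
  have := loop_induct (G := G) (H := H) (x := 0)
    (b := store 0 (.var 0) (.num 0) (.num 1)) (s := s)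
    (fun k s' => ∀ v : Fin n, (v : ℕ) < k → v ∈ marked n 0 s') (by simp)
    (by
      intro k s' h v hv
      by_cases hvk : (v : ℕ) = k
      · simp [marked, run, Expr.eval, hvk]
      · have : s'.tab 0 v 0 ≠ 0 := h v (by omega)
        simp [marked, run, Expr.eval, hvk, this])
    (fun _ h => h)
  exact Set.eq_univ_of_forall fun v => this v v.2

theorem dist_le_diam (hG : G.Connected) (a b : Fin n) : G.dist a b ≤ G.diam := by
  have : Nonempty (Fin n) := ⟨a⟩
  exact SimpleGraph.dist_le_diam (SimpleGraph.connected_iff_ediam_ne_top.1 hG)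

theorem run_learner (hG : G.Connected) (hH : IsMConvex G H) (hH' : IsMConvex G Hᶜ) :
    marked n 0 (learner.run G H State.init) = H ∧
      learner.queries G H State.init ≤
        2 * mHullNumber G + Nat.clog 2 G.diam + 2 * G.cliqueNum := by
  classical
  have hd : DistTable G (distProg.run G H State.init) := run_distProg hG (fun _ _ => rfl)
  obtain ⟨hS, hmin⟩ := run_minimalProg (G := G) (H := H) (distProg.run G H State.init)
  have hreg : ∀ x, x ∉ (seq distProg minimalProg).regs →
      (minimalProg.run G H (distProg.run G H State.init)).reg x = 0 := fun x hx => by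
    rw [← run_seq, run_reg hx]; rfl
  have htab : ∀ x, x ∉ (seq distProg minimalProg).tabs → ∀ i j,
      (minimalProg.run G H (distProg.run G H State.init)).tab x i j = 0 := fun x hx i j => by
    rw [← run_seq, run_tab hx]; rfl
  have hd' : DistTable G (minimalProg.run G H (distProg.run G H State.init)) := by
    intro i j
    rw [run_tab (by decide)]
    exact hd i j
  have hq0 : learner.queries G H State.init = queries G H (seq queryProg
    (ite (.var 10)
      (ite (.var 12) (seq searchProg (seq labelProg spreadProg))
        (loop 0 (store 0 (.var 0) (.num 0) (.num 1))))
      skip)) (minimalProg.run G H (distProg.run G H State.init)) := by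
    rw [learner, queries, queries, queries_of_silent (c := distProg) (by decide),
      queries_of_silent (c := minimalProg) (by decide), zero_add, zero_add]
  rw [hq0, learner, run_seq, run_seq]
  have h10 := hreg 10 (by decide)
  have h12 := hreg 12 (by decide)
  have t0 := htab 0 (by decide)
  have t4 := htab 4 (by decide)
  generalize minimalProg.run G H (distProg.run G H State.init) = s at *
  clear hq0 hreg htab hd
  obtain ⟨hex, hqq⟩ := run_queryProg (G := G) (H := H) h10 h12
  have hcard : (Finset.univ.filter (· ∈ marked n 1 s)).card ≤ 2 * mHullNumber G := by
    refine card_le_of_minimal (by simpa using hS) fun v hv => ?_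
    have := hmin v (by simpa using hv)
    convert this using 2
    ext w
    simp [and_comm]
  rw [queries, run_seq, hqq]
  have u0 : ∀ i j, (queryProg.run G H s).tab 0 i j = 0 := fun i j => by
    rw [run_tab (by decide), t0]
  have u4 : ∀ i j, (queryProg.run G H s).tab 4 i j = 0 := fun i j => by
    rw [run_tab (by decide), t4]
  have ud : DistTable G (queryProg.run G H s) := fun i j => by
    rw [run_tab (by decide)]; exact hd' i j
  generalize queryProg.run G H s = s₁ at *
  obtain ⟨e1, e2, e3, e4⟩ := hex
  by_cases k10 : s₁.reg 10 = 0
  · have hempty : H = ∅ := by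
      -- With no positive example, the queried hull set lies in the convex set `Hᶜ`, and so does its
      -- hull, which is everything.
      have : mHull G (marked n 1 s) ⊆ Hᶜ := mHull_subset hH' (e1 k10)
      rw [hS] at this
      rwa [Set.univ_subset_iff, Set.compl_univ_iff] at this
    constructor
    · simp [run, Expr.eval, k10, marked, u0, hempty]
    · simp only [queries, Expr.eval, k10, if_true]
      omega
  obtain ⟨a, h9, ha⟩ := e2 k10
  by_cases k12 : s₁.reg 12 = 0
  · have hfull : H = Set.univ := by
      have : mHull G (marked n 1 s) ⊆ H := mHull_subset hH (e3 k12)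
      rwa [hS, Set.univ_subset_iff] at this
    constructor
    · have : run G H (ite (.var 10) (ite (.var 12) (seq searchProg (seq labelProg spreadProg))
          (loop 0 (store 0 (.var 0) (.num 0) (.num 1)))) skip) s₁ =
          (loop 0 (store 0 (.var 0) (.num 0) (.num 1))).run G H s₁ := by
        rw [run, if_neg (by exact k10), run, if_pos (by exact k12)]
      rw [this, marked_fill, hfull]
    · have : queries G H (ite (.var 10) (ite (.var 12) (seq searchProg (seq labelProg spreadProg))
          (loop 0 (store 0 (.var 0) (.num 0) (.num 1)))) skip) s₁ = 0 := by
        rw [queries, if_neg (by exact k10), queries, if_pos (by exact k12)]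
        exact queries_of_silent (by decide) _
      omega
  obtain ⟨b, h11, hb⟩ := e4 k12
  obtain ⟨a', b', h9', h11', ha', hb', hab, hqs⟩ := run_searchProg hG ud h9 h11 ha hb
  have hclog := Nat.clog_mono_right 2 (dist_le_diam hG a b)
  rw [run, if_neg (by exact k10), run, if_neg (by exact k12), queries, if_neg (by exact k10),
    queries, if_neg (by exact k12), run_seq, run_seq, queries, queries,
    queries_of_silent (c := spreadProg) (by decide)]
  have w0 : ∀ i j, (searchProg.run G H s₁).tab 0 i j = 0 := fun i j => by
    rw [run_tab (by decide), u0]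
  have w4 : ∀ i j, (searchProg.run G H s₁).tab 4 i j = 0 := fun i j => by
    rw [run_tab (by decide), u4]
  generalize searchProg.run G H s₁ = s₂ at *
  obtain ⟨hlab, hlq⟩ := run_labelProg hG hH hH' w4 h9' h11' ha' hb' hab
  constructor
  · refine run_spreadProg hG hH hH' hlab (fun i j => ?_) ?_ ha' hb' hab
    · rw [run_tab (by decide), w0]
    · rw [run_reg (by decide), h9']
  · have := card_triangles_le hG hH hH' ha' hb'
      (Finset.univ.filter fun v => G.Adj a' v ∧ G.Adj b' v) (by simp)
    omega

/-- The factor 2 bounds `1 / log 2`, and the 1 pays for rounding up. For `d = 0` both logarithms are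
0 by convention. -/
theorem clog_le (d : ℕ) : (Nat.clog 2 d : ℝ) ≤ 2 * Real.log d + 1 := by
  rcases Nat.eq_zero_or_pos d with rfl | hd
  · simp
  have h1 : Nat.clog 2 d ≤ Nat.log 2 d + 1 :=
    Nat.clog_le_of_le_pow (Nat.lt_pow_succ_log_self (by norm_num) d).le
  have h2 : (Nat.log 2 d : ℝ) ≤ Real.logb 2 d := by exact_mod_cast Real.natLog_le_logb d 2
  have h3 : Real.logb 2 d ≤ 2 * Real.log d := by
    rw [Real.logb, div_le_iff₀ (Real.log_pos (by norm_num))]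
    have hl : 0 ≤ Real.log d := Real.log_natCast_nonneg d
    nlinarith [Real.log_two_gt_d9]
  have h4 : (Nat.clog 2 d : ℝ) ≤ Nat.log 2 d + 1 := by exact_mod_cast h1
  linarith

end

end Monophonic

theorem mainTheorem7 :
    ∃ (P : Monophonic.Cmd) (p : Polynomial ℕ) (C : ℝ),
      ∀ (n : ℕ) (G : SimpleGraph (Fin n)), G.Connected →
        Monophonic.ActivelyLearns P G (Monophonic.mHalfspaces G) (p.eval n)
          (C * (Monophonic.mHullNumber G + Real.log G.diam + G.cliqueNum)) := by
  -- The learner makes at most `2h + (2 log diam + 1) + 2ω` queries; the stray 1 is absorbed by `ω ≥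
  -- 1`, so 3 suffices.
  refine ⟨Monophonic.learner.compile, Monophonic.learner.time, 3, ?_⟩
  rintro n G hG H ⟨hH, hH'⟩
  obtain ⟨t, ht, hexec⟩ := Monophonic.Prog.exec_compile (G := G) (H := H)
    (c := Monophonic.learner) (by decide) Monophonic.State.init
  obtain ⟨hout, hq⟩ := Monophonic.run_learner hG hH hH'
  refine ⟨_, t, _, hexec, hout, ht, ?_⟩
  have hω : 1 ≤ G.cliqueNum := by
    obtain ⟨v⟩ := hG.nonempty
    simpa using SimpleGraph.IsClique.card_le_cliqueNum (G := G) (t := {v}) (tc := by simp)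
  have h1 := Monophonic.clog_le G.diam
  have h2 : (Monophonic.learner.queries G H Monophonic.State.init : ℝ) ≤
      2 * Monophonic.mHullNumber G + Nat.clog 2 G.diam + 2 * G.cliqueNum := by exact_mod_cast hq
  have h3 : (1 : ℝ) ≤ G.cliqueNum := by exact_mod_cast hω
  have h4 : 0 ≤ Real.log G.diam := Real.log_natCast_nonneg _
  have h5 : (0 : ℝ) ≤ Monophonic.mHullNumber G := Nat.cast_nonneg _
  linarith
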